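/- Let $\ell \ge 2$ and $t \ge 2$ be integers. The theta graph $\Theta_\ell^t$ is the graph consisting of $t$ paths with $\ell$ edges each between the same two distinct vertices, any two of which share no vertex other than these two end vertices. There exists a constant $C = C(\ell,t) > 0$, depending only on $\ell$ and $t$, such that for all integers $s \ge 2$ and $n \ge 1$, every simple graph $G$ on $n$ vertices that does not contain $K_{s,s}$ as a (not necessarily induced) subgraph and has at least \[ C \cdot (\ell t)^{20s} \cdot n^{1+\frac{1}{\ell}} \] edges contains $\Theta_\ell^t$ as an induced subgraph. -/

import Mathlib

/-- Vertices of the theta graph: `Sum.inl false` and `Sum.inl true` are the common first and last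
vertex of the `t` paths, and `Sum.inr (i, j)` is the `(j + 1)`-st of the `ℓ - 1` internal vertices
of the `i`-th path, counted from the first vertex. -/
abbrev ThetaVertex (ℓ t : ℕ) : Type := Bool ⊕ (Fin t × Fin (ℓ - 1))

/-- `ThetaStep ℓ t x y`: some path, traversed from its first to its last vertex, visits `y`
immediately after `x`. -/
def ThetaStep (ℓ t : ℕ) : ThetaVertex ℓ t → ThetaVertex ℓ t → Prop
  | Sum.inl false, Sum.inr (_, j) => (j : ℕ) = 0
  | Sum.inr (i, j), Sum.inr (i', j') => i = i' ∧ (j : ℕ) + 1 = (j' : ℕ)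
  | Sum.inr (_, j), Sum.inl true => (j : ℕ) + 2 = ℓ
  | _, _ => False

/-- The theta graph `Θ_ℓ^t` (for `ℓ ≥ 2`): `t` paths with `ℓ` edges each between the same two
vertices, pairwise sharing only these two vertices. -/
def thetaGraph (ℓ t : ℕ) : SimpleGraph (ThetaVertex ℓ t) :=
  SimpleGraph.fromRel (ThetaStep ℓ t)

/-! Pass to a nonempty induced subgraph with minimum degree at least `δ = (ℓt)^(20s+16) n^(1/ℓ)`,
where `n` is the original order, and let `M = D^(-1/2) A D^(-1/2)` be its normalized adjacency
matrix. Weight each walk by the product of the entries of `M` along it. Pairs of walks of length `ℓ`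
with common ends, that is, closed walks of length `2ℓ`, have total weight `T = tr M^(2ℓ)`, and `T ≥
1` since `1` is an eigenvalue.

Collisions are rare (`sum_sq_normalizedAdjMatrix_pow_le`). The weight of pairs meeting at step `i`
is `∑ z, (M^(2i)) z z * (M^(2(ℓ-i))) z z`. A correlation inequality for spectral moments reduces
this to the split `1, ℓ-1`. There `(M^2) z z ≤ 1/δ`, and `tr M^(2ℓ-2) ≤ 2N T` with `N^ℓ` the order
of the subgraph, so the collision weight is at most `(2N/δ) T`.

Adjacencies are rare too (`sum_close_opposite_le`). For fixed ends, the `i`-th and `j`-th vertices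
of two walks follow two distributions. If neither has a heavy atom, a weighted Kővári–Sós–Turán
argument (`sum_closeIndicator_le`) bounds the chance that the two vertices are equal or adjacent;
heavy atoms are paid for by collisions. Two vertices of the same walk are handled by rotating the
closed walk until they lie on opposite sides.

Hence some pair of ends has few conflicts relative to its weight, and a greedy choice
(`exists_pairwise_lt_one`) yields `t` conflict-free walks, which form an induced theta graph. -/

/-! ### Spectral moments of symmetric matrices -/

/-- Diagonal entries of powers of a real symmetric matrix as moments of its eigenvalues. -/
theorem Matrix.IsHermitian.pow_apply_self {V : Type*} [Fintype V] [DecidableEq V]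
    {M : Matrix V V ℝ} (hM : M.IsHermitian) (j : ℕ) (z : V) :
    (M ^ j) z z = ∑ k, hM.eigenvalues k ^ j * (hM.eigenvectorUnitary.1 z k) ^ 2 := by
  have h : M ^ j = hM.eigenvectorUnitary.1 *
      Matrix.diagonal (fun k => hM.eigenvalues k ^ j) * star hM.eigenvectorUnitary.1 := by
    conv_lhs => rw [hM.spectral_theorem, ← map_pow, Unitary.conjStarAlgAut_apply,
      Matrix.diagonal_pow]
    rfl
  rw [h, Matrix.mul_apply]
  refine Finset.sum_congr rfl fun k _ => ?_
  rw [Matrix.mul_diagonal, Matrix.star_apply, star_trivial]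
  ring

theorem Matrix.IsHermitian.sum_eigenvectorUnitary_sq {V : Type*} [Fintype V] [DecidableEq V]
    {M : Matrix V V ℝ} (hM : M.IsHermitian) (k : V) :
    ∑ z, (hM.eigenvectorUnitary.1 z k) ^ 2 = 1 := by
  have h := congrFun (congrFun (Unitary.coe_star_mul_self hM.eigenvectorUnitary) k) k
  rw [Matrix.mul_apply, Matrix.one_apply_eq] at h
  rw [← h]
  refine Finset.sum_congr rfl fun z _ => ?_
  rw [Matrix.star_apply, star_trivial, sq]

theorem Matrix.IsHermitian.sum_pow_apply_self {V : Type*} [Fintype V] [DecidableEq V]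
    {M : Matrix V V ℝ} (hM : M.IsHermitian) (j : ℕ) :
    ∑ z, (M ^ j) z z = ∑ k, hM.eigenvalues k ^ j := by
  simp_rw [hM.pow_apply_self]
  rw [Finset.sum_comm]
  simp_rw [← Finset.mul_sum, hM.sum_eigenvectorUnitary_sq, mul_one]

/-- The difference of the two sides is `x y (x^a - y^a)(x^b - y^b)`, whose last two factors have the
same sign. -/
theorem pow_mul_pow_add_swap_le {x y : ℝ} (hx : 0 ≤ x) (hy : 0 ≤ y) (a b : ℕ) :
    x ^ (a + 1) * y ^ (b + 1) + y ^ (a + 1) * x ^ (b + 1)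
      ≤ x * y ^ (a + b + 1) + y * x ^ (a + b + 1) := by
  have key : 0 ≤ (x ^ a - y ^ a) * (x ^ b - y ^ b) := by
    rcases le_total x y with h | h
    · exact mul_nonneg_of_nonpos_of_nonpos (sub_nonpos.2 (pow_le_pow_left₀ hx h a))
        (sub_nonpos.2 (pow_le_pow_left₀ hx h b))
    · exact mul_nonneg (sub_nonneg.2 (pow_le_pow_left₀ hy h a))
        (sub_nonneg.2 (pow_le_pow_left₀ hy h b))
  have := mul_nonneg (mul_nonneg hx hy) key
  calc _ ≤ x ^ (a + 1) * y ^ (b + 1) + y ^ (a + 1) * x ^ (b + 1)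
        + x * y * ((x ^ a - y ^ a) * (x ^ b - y ^ b)) := le_add_of_nonneg_right this
    _ = _ := by ring

/-- Correlation inequality for moments of a measure on the nonnegative reals. -/
theorem moment_mul_moment_le {K : Type*} [Fintype K] (x p : K → ℝ) (hx : ∀ k, 0 ≤ x k)
    (hp : ∀ k, 0 ≤ p k) (a b : ℕ) :
    (∑ k, x k ^ (a + 1) * p k) * (∑ k, x k ^ (b + 1) * p k)
      ≤ (∑ k, x k * p k) * (∑ k, x k ^ (a + b + 1) * p k) := by
  -- Symmetrizing over two independent copies of the measure reduces the claim to a pointwise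
  -- inequality.
  have symm : ∀ f g : K → ℝ, 2 * ((∑ k, f k * p k) * (∑ k, g k * p k))
      = ∑ k, ∑ l, (f k * g l + f l * g k) * (p k * p l) := by
    intro f g
    have h1 : (∑ k, f k * p k) * (∑ k, g k * p k) = ∑ k, ∑ l, f k * g l * (p k * p l) := by
      rw [Finset.sum_mul_sum]
      exact Finset.sum_congr rfl fun k _ => Finset.sum_congr rfl fun l _ => by ring
    have h2 : (∑ k, f k * p k) * (∑ k, g k * p k) = ∑ k, ∑ l, f l * g k * (p k * p l) := by
      rw [h1, Finset.sum_comm]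
      exact Finset.sum_congr rfl fun k _ => Finset.sum_congr rfl fun l _ => by ring
    rw [two_mul]
    nth_rewrite 1 [h1]
    rw [h2]
    simp_rw [← Finset.sum_add_distrib, ← add_mul]
  have := symm (fun k => x k ^ (a + 1)) (fun k => x k ^ (b + 1))
  have := symm x (fun k => x k ^ (a + b + 1))
  have h : ∑ k, ∑ l, (x k ^ (a + 1) * x l ^ (b + 1) + x l ^ (a + 1) * x k ^ (b + 1)) * (p k * p l)
      ≤ ∑ k, ∑ l, (x k * x l ^ (a + b + 1) + x l * x k ^ (a + b + 1)) * (p k * p l) :=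
    Finset.sum_le_sum fun k _ => Finset.sum_le_sum fun l _ =>
      mul_le_mul_of_nonneg_right (pow_mul_pow_add_swap_le (hx k) (hx l) a b)
        (mul_nonneg (hp k) (hp l))
  linarith

/-- The diagonal entries at `z` are moments of the squared eigenvalues under the spectral measure of
`z`, so the correlation inequality applies. -/
theorem Matrix.IsHermitian.pow_apply_self_mul_le {V : Type*} [Fintype V] [DecidableEq V]
    {M : Matrix V V ℝ} (hM : M.IsHermitian) (a b : ℕ) (z : V) :
    (M ^ (2 * (a + 1))) z z * (M ^ (2 * (b + 1))) z z
      ≤ (M ^ 2) z z * (M ^ (2 * (a + b + 1))) z z := by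
  simp_rw [hM.pow_apply_self, pow_mul]
  exact moment_mul_moment_le _ _ (fun k => sq_nonneg _) (fun k => sq_nonneg _) a b

/-- If `1` is an eigenvalue, consecutive even traces differ by a factor at most `2 N`, where
`N ^ (m + 1)` is the dimension. -/
theorem Matrix.IsHermitian.trace_pow_le {V : Type*} [Fintype V] [DecidableEq V]
    {M : Matrix V V ℝ} (hM : M.IsHermitian) (h1 : 1 ≤ ∑ z, (M ^ (2 * (m + 1))) z z)
    {N : ℝ} (hN : 0 < N) (hNV : N ^ (m + 1) = Fintype.card V) :
    ∑ z, (M ^ (2 * m)) z z ≤ 2 * N * ∑ z, (M ^ (2 * (m + 1))) z z := by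
  rw [hM.sum_pow_apply_self] at h1 ⊢
  rw [hM.sum_pow_apply_self]
  -- Squared eigenvalues above `1/N` gain a factor `N` from one more power. Each of the others
  -- contributes at most `N^(-m)`, in total at most `N`, which is absorbed because the larger trace
  -- is at least `1`.
  have hpt : ∀ k, hM.eigenvalues k ^ (2 * m)
      ≤ N * hM.eigenvalues k ^ (2 * (m + 1)) + (N ^ m)⁻¹ := by
    intro k
    rw [pow_mul, pow_mul]
    have hx := sq_nonneg (hM.eigenvalues k)
    set x := hM.eigenvalues k ^ 2
    rcases le_total 1 (N * x) with h | h
    · calc x ^ m ≤ (N * x) * x ^ m := le_mul_of_one_le_left (pow_nonneg hx m) h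
        _ = N * x ^ (m + 1) := by ring
        _ ≤ _ := le_add_of_nonneg_right (by positivity)
    · calc x ^ m ≤ (N⁻¹) ^ m := pow_le_pow_left₀ hx (by
            rw [← one_div, le_div_iff₀ hN, mul_comm]; exact h) m
        _ = (N ^ m)⁻¹ := inv_pow _ _
        _ ≤ _ := le_add_of_nonneg_left (by positivity)
  calc _ ≤ ∑ k, (N * hM.eigenvalues k ^ (2 * (m + 1)) + (N ^ m)⁻¹) :=
        Finset.sum_le_sum fun k _ => hpt k
    _ = N * ∑ k, hM.eigenvalues k ^ (2 * (m + 1)) + N := by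
        rw [Finset.sum_add_distrib, ← Finset.mul_sum, Finset.sum_const, Finset.card_univ,
          nsmul_eq_mul, ← hNV, pow_succ]
        field_simp
    _ ≤ _ := by nlinarith

theorem Matrix.IsHermitian.one_le_trace_pow {V : Type*} [Fintype V] [DecidableEq V]
    {M : Matrix V V ℝ} (hM : M.IsHermitian) {v : V → ℝ} (hv : v ≠ 0) (hMv : M.mulVec v = v)
    (m : ℕ) : 1 ≤ ∑ z, (M ^ (2 * m)) z z := by
  have hs : (1 : ℝ) ∈ spectrum ℝ M := by
    rw [← Matrix.spectrum_toLin']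
    refine Module.End.HasEigenvalue.mem_spectrum
      (Module.End.hasEigenvalue_of_hasEigenvector (x := v) ⟨?_, hv⟩)
    rw [Module.End.mem_eigenspace_iff, Matrix.toLin'_apply, hMv, one_smul]
  rw [hM.spectrum_real_eq_range_eigenvalues] at hs
  obtain ⟨k, hk⟩ := hs
  rw [hM.sum_pow_apply_self]
  calc (1 : ℝ) = hM.eigenvalues k ^ (2 * m) := by rw [hk, one_pow]
    _ ≤ _ := Finset.single_le_sum
      (f := fun k => hM.eigenvalues k ^ (2 * m))
      (fun k _ => by rw [pow_mul]; positivity) (Finset.mem_univ k)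

/-! ### The normalized adjacency matrix and collisions -/

/-- The symmetrically normalized adjacency matrix. -/
noncomputable def normalizedAdjMatrix {V : Type*} [Fintype V] (G : SimpleGraph V)
    [DecidableRel G.Adj] : Matrix V V ℝ :=
  Matrix.of fun x y => G.adjMatrix ℝ x y * ((√(G.degree x : ℝ))⁻¹ * (√(G.degree y : ℝ))⁻¹)

theorem normalizedAdjMatrix_apply {V : Type*} [Fintype V] (G : SimpleGraph V)
    [DecidableRel G.Adj] (x y : V) : normalizedAdjMatrix G x y =
      G.adjMatrix ℝ x y * ((√(G.degree x : ℝ))⁻¹ * (√(G.degree y : ℝ))⁻¹) := rfl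

theorem normalizedAdjMatrix_nonneg {V : Type*} [Fintype V] (G : SimpleGraph V)
    [DecidableRel G.Adj] (x y : V) : 0 ≤ normalizedAdjMatrix G x y := by
  rw [normalizedAdjMatrix_apply, SimpleGraph.adjMatrix_apply]
  split_ifs <;> positivity

theorem adj_of_normalizedAdjMatrix_ne_zero {V : Type*} [Fintype V] (G : SimpleGraph V)
    [DecidableRel G.Adj] {x y : V} (h : normalizedAdjMatrix G x y ≠ 0) : G.Adj x y := by
  by_contra hn
  exact h (by rw [normalizedAdjMatrix_apply, SimpleGraph.adjMatrix_apply, if_neg hn, zero_mul])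

theorem normalizedAdjMatrix_comm {V : Type*} [Fintype V] (G : SimpleGraph V)
    [DecidableRel G.Adj] (x y : V) : normalizedAdjMatrix G x y = normalizedAdjMatrix G y x := by
  simp only [normalizedAdjMatrix_apply, SimpleGraph.adjMatrix_apply, G.adj_comm x y]
  ring

theorem normalizedAdjMatrix_isHermitian {V : Type*} [Fintype V] (G : SimpleGraph V)
    [DecidableRel G.Adj] : (normalizedAdjMatrix G).IsHermitian :=
  Matrix.IsHermitian.ext fun x y => by rw [star_trivial, normalizedAdjMatrix_comm]

theorem sum_adjMatrix_apply {V : Type*} [Fintype V] (G : SimpleGraph V)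
    [DecidableRel G.Adj] (x : V) : ∑ y, G.adjMatrix ℝ x y = G.degree x := by
  simp [SimpleGraph.adjMatrix_apply, Finset.sum_boole, SimpleGraph.card_neighborFinset_eq_degree,
    ← SimpleGraph.neighborFinset_eq_filter]

theorem normalizedAdjMatrix_mulVec_sqrt_degree {V : Type*} [Fintype V] (G : SimpleGraph V)
    [DecidableRel G.Adj] (hd : ∀ x, 0 < G.degree x) :
    (normalizedAdjMatrix G).mulVec (fun x => √(G.degree x : ℝ)) =
      fun x => √(G.degree x : ℝ) := by
  have hpos : ∀ x, 0 < √(G.degree x : ℝ) := fun x => Real.sqrt_pos.2 (Nat.cast_pos.2 (hd x))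
  funext x
  calc ∑ y, normalizedAdjMatrix G x y * √(G.degree y : ℝ)
      = ∑ y, G.adjMatrix ℝ x y * (√(G.degree x : ℝ))⁻¹ := by
        refine Finset.sum_congr rfl fun y _ => ?_
        rw [normalizedAdjMatrix_apply, mul_assoc, mul_assoc, inv_mul_cancel₀ (hpos y).ne', mul_one]
    _ = √(G.degree x : ℝ) := by
        rw [← Finset.sum_mul, sum_adjMatrix_apply, ← div_eq_mul_inv, Real.div_sqrt]

theorem normalizedAdjMatrix_sq_apply_self_le {V : Type*} [Fintype V] [DecidableEq V]
    (G : SimpleGraph V) [DecidableRel G.Adj] {δ : ℝ} (hδ : 0 < δ) (hd : ∀ x, δ ≤ G.degree x)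
    (z : V) : (normalizedAdjMatrix G ^ 2) z z ≤ δ⁻¹ := by
  have hpos : ∀ x, (0 : ℝ) < G.degree x := fun x => hδ.trans_le (hd x)
  rw [sq, Matrix.mul_apply]
  calc ∑ u, normalizedAdjMatrix G z u * normalizedAdjMatrix G u z
      ≤ ∑ u, G.adjMatrix ℝ z u * ((G.degree z : ℝ)⁻¹ * δ⁻¹) := by
        refine Finset.sum_le_sum fun u _ => ?_
        rw [normalizedAdjMatrix_comm G u z, normalizedAdjMatrix_apply, SimpleGraph.adjMatrix_apply]
        split_ifs
        · rw [one_mul, one_mul, mul_mul_mul_comm, ← mul_inv, ← mul_inv,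
            Real.mul_self_sqrt (hpos z).le, Real.mul_self_sqrt (hpos u).le]
          exact mul_le_mul_of_nonneg_left (inv_anti₀ hδ (hd u)) (inv_nonneg.2 (hpos z).le)
        · simp
    _ = δ⁻¹ := by
        rw [← Finset.sum_mul, sum_adjMatrix_apply, ← mul_assoc, mul_inv_cancel₀ (hpos z).ne',
          one_mul]

theorem Matrix.pow_apply_comm_of_symm {V : Type*} [Fintype V] [DecidableEq V]
    {M : Matrix V V ℝ} (hM : M.IsHermitian) (i : ℕ) (x y : V) : (M ^ i) x y = (M ^ i) y x := by
  have h := (hM.pow i).apply y x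
  rw [star_trivial] at h
  exact h

theorem Matrix.pow_add_apply_symm {V : Type*} [Fintype V] [DecidableEq V]
    {M : Matrix V V ℝ} (hM : M.IsHermitian) (i j : ℕ) (x y : V) :
    (M ^ (i + j)) x y = ∑ u, (M ^ i) u x * (M ^ j) u y := by
  rw [pow_add, Matrix.mul_apply]
  exact Finset.sum_congr rfl fun u _ => by rw [Matrix.pow_apply_comm_of_symm hM i x u]

/-- For fixed `z` the sum factors over `u` and `v`, and by symmetry each factor is a diagonal entry
of an even power. -/
theorem sum_sq_pow_mul_pow {V : Type*} [Fintype V] [DecidableEq V]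
    {M : Matrix V V ℝ} (hM : M.IsHermitian) (i j : ℕ) :
    ∑ u, ∑ v, ∑ z, ((M ^ i) u z * (M ^ j) z v) ^ 2
      = ∑ z, (M ^ (2 * i)) z z * (M ^ (2 * j)) z z := by
  have h1 : ∀ z, (M ^ (2 * i)) z z = ∑ u, ((M ^ i) u z) ^ 2 := fun z => by
    rw [two_mul, Matrix.pow_add_apply_symm hM]
    exact Finset.sum_congr rfl fun u _ => (sq _).symm
  have h2 : ∀ z, (M ^ (2 * j)) z z = ∑ v, ((M ^ j) z v) ^ 2 := fun z => by
    rw [two_mul, Matrix.pow_add_apply_symm hM]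
    exact Finset.sum_congr rfl fun u _ => by rw [Matrix.pow_apply_comm_of_symm hM j u z, sq]
  simp_rw [h1, h2, Finset.sum_mul_sum, mul_pow]
  rw [Finset.sum_comm' (t' := Finset.univ) (s' := fun _ => Finset.univ) (by simp)]
  conv_rhs => rw [Finset.sum_comm]; enter [2, u]; rw [Finset.sum_comm]
  rw [Finset.sum_comm]

theorem one_le_trace_normalizedAdjMatrix_pow {V : Type*} [Fintype V] [DecidableEq V] [Nonempty V]
    (G : SimpleGraph V) [DecidableRel G.Adj] (hd : ∀ x, 0 < G.degree x) (m : ℕ) :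
    1 ≤ ∑ z, (normalizedAdjMatrix G ^ (2 * m)) z z := by
  refine (normalizedAdjMatrix_isHermitian G).one_le_trace_pow (fun h => ?_)
    (normalizedAdjMatrix_mulVec_sqrt_degree G hd) m
  obtain ⟨x⟩ := ‹Nonempty V›
  exact (Real.sqrt_pos.2 (Nat.cast_pos.2 (hd x))).ne' (congrFun h x)

/-- In a graph of large minimum degree, few weighted closed walks of length `2 ℓ` have a coincidence
between opposite vertices. -/
theorem sum_sq_normalizedAdjMatrix_pow_le {V : Type*} [Fintype V] [DecidableEq V] [Nonempty V]
    (G : SimpleGraph V) [DecidableRel G.Adj] {δ N : ℝ} (hδ : 0 < δ) (hd : ∀ x, δ ≤ G.degree x)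
    (a b : ℕ) (hN : 0 < N) (hNV : N ^ (a + b + 2) = Fintype.card V) :
    ∑ u, ∑ v, ∑ z, ((normalizedAdjMatrix G ^ (a + 1)) u z *
        (normalizedAdjMatrix G ^ (b + 1)) z v) ^ 2
      ≤ 2 * N / δ * ∑ z, (normalizedAdjMatrix G ^ (2 * (a + b + 2))) z z := by
  have hM := normalizedAdjMatrix_isHermitian G
  have hpos : ∀ x, 0 < G.degree x := fun x => Nat.cast_pos.1 (hδ.trans_le (hd x))
  rw [sum_sq_pow_mul_pow hM]
  have h1 := one_le_trace_normalizedAdjMatrix_pow G hpos (a + b + 2)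
  have h2 := hM.trace_pow_le (m := a + b + 1) h1 hN hNV
  calc _ ≤ ∑ z, (normalizedAdjMatrix G ^ 2) z z *
          (normalizedAdjMatrix G ^ (2 * (a + b + 1))) z z :=
        Finset.sum_le_sum fun z _ => hM.pow_apply_self_mul_le a b z
    _ ≤ ∑ z, δ⁻¹ * (normalizedAdjMatrix G ^ (2 * (a + b + 1))) z z :=
        Finset.sum_le_sum fun z _ => mul_le_mul_of_nonneg_right
          (normalizedAdjMatrix_sq_apply_self_le G hδ hd z)
          (Matrix.pow_apply_nonneg (normalizedAdjMatrix_nonneg G) _ _ _)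
    _ = δ⁻¹ * ∑ z, (normalizedAdjMatrix G ^ (2 * (a + b + 1))) z z := (Finset.mul_sum ..).symm
    _ ≤ δ⁻¹ * (2 * N * ∑ z, (normalizedAdjMatrix G ^ (2 * (a + b + 2))) z z) :=
        mul_le_mul_of_nonneg_left h2 (inv_nonneg.2 hδ.le)
    _ = _ := by ring

/-! ### Weighted walks and matrix powers -/

/-- The weight of a walk `p` of length `n`, if it goes from `u` to `v`. -/
def walkWeight {V : Type*} [DecidableEq V] (M : Matrix V V ℝ) (n : ℕ) (u v : V)
    (p : Fin (n + 1) → V) : ℝ :=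
  if p 0 = u ∧ p (Fin.last n) = v then ∏ i : Fin n, M (p i.castSucc) (p i.succ) else 0

theorem walkWeight_nonneg {V : Type*} [DecidableEq V] {M : Matrix V V ℝ}
    (hM : ∀ x y, 0 ≤ M x y) (n : ℕ) (u v : V) (p : Fin (n + 1) → V) :
    0 ≤ walkWeight M n u v p := by
  unfold walkWeight
  split_ifs
  · exact Finset.prod_nonneg fun i _ => hM _ _
  · exact le_rfl

theorem walkWeight_succ_cons {V : Type*} [Fintype V] [DecidableEq V] (M : Matrix V V ℝ) (n : ℕ)
    (u v x : V) (p : Fin (n + 1) → V) :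
    walkWeight M (n + 1) u v (Fin.cons x p : Fin (n + 2) → V)
      = if x = u then ∑ y, M u y * walkWeight M n y v p else 0 := by
  have h : ∑ y, M u y * walkWeight M n y v p = M u (p 0) * walkWeight M n (p 0) v p := by
    refine Finset.sum_eq_single _ (fun y _ hy => ?_) (fun h => absurd (Finset.mem_univ _) h)
    rw [walkWeight, if_neg fun h => hy h.1.symm, mul_zero]
  rw [h]
  unfold walkWeight
  rw [Fin.prod_univ_succ, ← Fin.succ_last]
  simp only [Fin.cons_zero, Fin.cons_succ, Fin.castSucc_zero, Fin.castSucc_succ, true_and]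
  split_ifs <;> simp_all

theorem sum_walkWeight_succ {V : Type*} [Fintype V] [DecidableEq V] (M : Matrix V V ℝ) (n : ℕ)
    (u v : V) (F : (Fin (n + 2) → V) → ℝ) :
    ∑ p, walkWeight M (n + 1) u v p * F p
      = ∑ y, M u y * ∑ p, walkWeight M n y v p * F (Fin.cons u p) := by
  rw [← (Fin.consEquiv fun _ : Fin (n + 2) => V).sum_comp, Fintype.sum_prod_type]
  simp only [Fin.consEquiv, Equiv.coe_fn_mk, walkWeight_succ_cons, ite_mul, zero_mul]
  rw [Finset.sum_eq_single u]
  · simp_rw [if_true, Finset.sum_mul, Finset.mul_sum]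
    rw [Finset.sum_comm]
    simp_rw [mul_assoc]
  · intro x _ hx
    simp [hx]
  · simp

theorem sum_walkWeight {V : Type*} [Fintype V] [DecidableEq V] (M : Matrix V V ℝ) (n : ℕ)
    (u v : V) : ∑ p, walkWeight M n u v p = (M ^ n) u v := by
  induction n generalizing u with
  | zero =>
    rw [← (Equiv.funUnique (Fin 1) V).symm.sum_comp]
    simp [walkWeight, Matrix.one_apply, ite_and, Equiv.funUnique]
  | succ n ih =>
    have := sum_walkWeight_succ M n u v (fun _ => 1)
    simp_rw [mul_one, ih] at this
    rw [this, pow_succ', Matrix.mul_apply]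

/-- Fixing the vertex at step `i` cuts the walk into two independent pieces, which gives the
(unnormalized) law of that vertex. -/
theorem sum_walkWeight_mul_apply {V : Type*} [Fintype V] [DecidableEq V] (M : Matrix V V ℝ)
    (n : ℕ) (u v : V) (i : ℕ) (hi : i < n + 1) (F : V → ℝ) :
    ∑ p, walkWeight M n u v p * F (p ⟨i, hi⟩)
      = ∑ y, F y * ((M ^ i) u y * (M ^ (n - i)) y v) := by
  induction n generalizing u i with
  | zero =>
    obtain rfl : i = 0 := by omega
    rw [← (Equiv.funUnique (Fin 1) V).symm.sum_comp]
    simp [walkWeight, Matrix.one_apply, ite_and, Equiv.funUnique]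
    split_ifs with h <;> simp [h]
  | succ n ih =>
    rw [sum_walkWeight_succ]
    cases i with
    | zero =>
      have : ∀ p : Fin (n + 1) → V, (Fin.cons u p : Fin (n + 2) → V) ⟨0, hi⟩ = u := fun p => rfl
      simp_rw [this, ← Finset.sum_mul, sum_walkWeight, ← mul_assoc, ← Finset.sum_mul]
      rw [← Matrix.mul_apply, ← pow_succ', pow_zero, mul_comm]
      simp [Matrix.one_apply]
    | succ i =>
      have : ∀ p : Fin (n + 1) → V, (Fin.cons u p : Fin (n + 2) → V) ⟨i + 1, hi⟩
          = p ⟨i, by omega⟩ := fun p => rfl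
      simp_rw [this, ih, Finset.mul_sum]
      rw [Finset.sum_comm]
      refine Finset.sum_congr rfl fun y _ => ?_
      rw [pow_succ', Matrix.mul_apply, Finset.sum_mul, Finset.mul_sum, Nat.add_sub_add_right]
      exact Finset.sum_congr rfl fun x _ => by ring

theorem sum_walkWeight_mul_apply₂ {V : Type*} [Fintype V] [DecidableEq V] (M : Matrix V V ℝ)
    (n : ℕ) (u v : V) (i j : ℕ) (hij : i ≤ j) (hj : j < n + 1) (F : V → V → ℝ) :
    ∑ p, walkWeight M n u v p * F (p ⟨i, by omega⟩) (p ⟨j, hj⟩)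
      = ∑ y, ∑ z, F y z * ((M ^ i) u y * (M ^ (j - i)) y z * (M ^ (n - j)) z v) := by
  induction n generalizing u i j with
  | zero =>
    obtain rfl : j = 0 := by omega
    obtain rfl : i = 0 := by omega
    rw [← (Equiv.funUnique (Fin 1) V).symm.sum_comp]
    simp [walkWeight, Matrix.one_apply, ite_and, Equiv.funUnique]
    split_ifs with h <;> simp [h]
  | succ n ih =>
    cases i with
    | zero =>
      -- A walk of nonzero weight starts at `u`, so the first argument of `F` is constant and one
      -- marked vertex remains.
      have h : ∀ p : Fin (n + 2) → V, walkWeight M (n + 1) u v p *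
          F (p ⟨0, by omega⟩) (p ⟨j, hj⟩) = walkWeight M (n + 1) u v p * F u (p ⟨j, hj⟩) := by
        intro p
        by_cases hp : p 0 = u
        · rw [← hp]; rfl
        · rw [walkWeight, if_neg fun h => hp h.1, zero_mul, zero_mul]
      simp_rw [h, sum_walkWeight_mul_apply]
      symm
      rw [Finset.sum_eq_single u]
      · simp
      · intro y _ hy
        simp [Matrix.one_apply_ne' hy]
      · simp
    | succ i =>
      obtain ⟨j, rfl⟩ : ∃ k, j = k + 1 := ⟨j - 1, by omega⟩
      rw [sum_walkWeight_succ]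
      have : ∀ p : Fin (n + 1) → V, (Fin.cons u p : Fin (n + 2) → V) ⟨i + 1, by omega⟩
          = p ⟨i, by omega⟩ := fun p => rfl
      have : ∀ p : Fin (n + 1) → V, (Fin.cons u p : Fin (n + 2) → V) ⟨j + 1, hj⟩
          = p ⟨j, by omega⟩ := fun p => rfl
      simp_rw [this, ‹∀ p : Fin (n + 1) → V, (Fin.cons u p : Fin (n + 2) → V) ⟨i + 1, _⟩
          = p ⟨i, _⟩›, ih _ i j (by omega) (by omega), Finset.mul_sum]
      rw [Finset.sum_comm]
      refine Finset.sum_congr rfl fun y _ => ?_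
      rw [Finset.sum_comm]
      refine Finset.sum_congr rfl fun z _ => ?_
      rw [pow_succ', Matrix.mul_apply, Finset.sum_mul, Finset.sum_mul, Finset.mul_sum,
        Nat.add_sub_add_right, Nat.add_sub_add_right]
      exact Finset.sum_congr rfl fun x _ => by ring

/-! ### A weighted Kővári–Sós–Turán theorem -/

/-- The indicator of being equal or adjacent. -/
noncomputable def closeIndicator {V : Type*} (G : SimpleGraph V) (x y : V) : ℝ :=
  Set.indicator {y | x = y ∨ G.Adj x y} (fun _ => 1) y

theorem closeIndicator_eq_one {V : Type*} {G : SimpleGraph V} {x y : V}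
    (h : x = y ∨ G.Adj x y) : closeIndicator G x y = 1 :=
  Set.indicator_of_mem (s := {y | x = y ∨ G.Adj x y}) h _

theorem closeIndicator_eq_zero {V : Type*} {G : SimpleGraph V} {x y : V}
    (h : ¬ (x = y ∨ G.Adj x y)) : closeIndicator G x y = 0 :=
  Set.indicator_of_notMem (s := {y | x = y ∨ G.Adj x y}) h _

theorem closeIndicator_nonneg {V : Type*} (G : SimpleGraph V) (x y : V) :
    0 ≤ closeIndicator G x y := by
  by_cases h : x = y ∨ G.Adj x y
  · rw [closeIndicator_eq_one h]; exact zero_le_one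
  · rw [closeIndicator_eq_zero h]

theorem closeIndicator_le_one {V : Type*} (G : SimpleGraph V) (x y : V) :
    closeIndicator G x y ≤ 1 := by
  by_cases h : x = y ∨ G.Adj x y
  · rw [closeIndicator_eq_one h]
  · rw [closeIndicator_eq_zero h]; exact zero_le_one

/-- Every vertex of `Z` is equal or adjacent to every vertex of `Y`, so `K_{s,s}` appears as soon
as `Y` has `2 s` vertices. -/
theorem card_lt_of_completeBipartiteGraph_free {V : Type*} [DecidableEq V]
    {G : SimpleGraph V} {s : ℕ} (hG : (completeBipartiteGraph (Fin s) (Fin s)).Free G)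
    {Z Y : Finset V} (hZ : Z.card = s) (h : ∀ z ∈ Z, ∀ y ∈ Y, z = y ∨ G.Adj z y) :
    Y.card < 2 * s := by
  by_contra hY
  have h1 : s ≤ (Y \ Z).card := by
    have := Finset.le_card_sdiff Z Y
    omega
  obtain ⟨W, hW, hWs⟩ := Finset.exists_subset_card_eq h1
  refine hG (SimpleGraph.completeBipartiteGraph_isContained_iff.2
    ⟨Z, W, by simpa using hZ, by simpa using hWs, ?_⟩)
  intro z hz w hw
  have hw' := Finset.mem_sdiff.1 (hW hw)
  rcases h z hz w hw'.1 with rfl | h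
  · exact absurd hz hw'.2
  · exact h

/-- A weighted form of the Kővári–Sós–Turán theorem. -/
theorem sum_closeIndicator_le {V : Type*} [Fintype V] [DecidableEq V]
    {G : SimpleGraph V} {s : ℕ} (hs : 0 < s)
    (hG : (completeBipartiteGraph (Fin s) (Fin s)).Free G)
    {α β : V → ℝ} (hα : ∀ z, 0 ≤ α z) (hβ : ∀ z, 0 ≤ β z) (hα1 : ∑ z, α z = 1)
    (hβ1 : ∑ z, β z = 1) {η c : ℝ} (hη : 0 < η) (hη1 : η ≤ 1)
    (hc : c = (η / 8) ^ s * η / (8 * s)) (hαc : ∀ z, α z ≤ c) (hβc : ∀ z, β z ≤ c) :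
    ∑ z, ∑ y, closeIndicator G z y * (α z * β y) ≤ η := by
  by_contra! hcon
  have hs' : (0 : ℝ) < s := Nat.cast_pos.2 hs
  have hc0 : 0 < c := by rw [hc]; positivity
  have hsc : s * c = (η / 8) ^ s * (η / 8) := by rw [hc]; field_simp
  -- The `α`-mass of the vertices equal or adjacent to `y`.
  set f : V → ℝ := fun y => ∑ z, α z * closeIndicator G z y with hf
  have hf1 : ∀ y, f y ≤ 1 := fun y => by
    rw [← hα1]
    exact Finset.sum_le_sum fun z _ => mul_le_of_le_one_right (hα z) (closeIndicator_le_one G z y)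
  set Y₀ : Finset V := Finset.univ.filter fun y => η / 2 ≤ f y with hY₀
  have hcon' : η < ∑ y, β y * f y := by
    refine hcon.trans_le (le_of_eq ?_)
    rw [Finset.sum_comm]
    refine Finset.sum_congr rfl fun y _ => ?_
    rw [hf, Finset.mul_sum]
    exact Finset.sum_congr rfl fun z _ => by ring
  -- Since `f ≤ 1` has `β`-average above `η`, the set where `f ≥ η / 2` carries `β`-mass at least `η
  -- / 2`.
  have hbase : η / 2 ≤ ∑ y ∈ Y₀, β y := by
    have h1 : ∑ y, β y * f y ≤ ∑ y, ((if y ∈ Y₀ then β y else 0) + β y * (η / 2)) := by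
      refine Finset.sum_le_sum fun y _ => ?_
      by_cases hy : y ∈ Y₀
      · rw [if_pos hy]
        nlinarith [hβ y, hf1 y, mul_le_of_le_one_right (hβ y) (hf1 y), mul_nonneg (hβ y) hη.le]
      · rw [if_neg hy, zero_add]
        refine mul_le_mul_of_nonneg_left ?_ (hβ y)
        by_contra! h
        exact hy (Finset.mem_filter.2 ⟨Finset.mem_univ _, h.le⟩)
    rw [Finset.sum_add_distrib, ← Finset.sum_mul, hβ1, Finset.sum_ite_mem, Finset.univ_inter] at h1
    linarith
  -- Vertices `z` are added one at a time; each can be chosen so that its close vertices keep a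
  -- fraction `η / 8` of the `β`-mass of `Y`.
  have key : ∀ k ≤ s, ∃ Z Y : Finset V, Z.card = k ∧ Y ⊆ Y₀ ∧
      (∀ z ∈ Z, ∀ y ∈ Y, z = y ∨ G.Adj z y) ∧ (η / 8) ^ k * (η / 2) ≤ ∑ y ∈ Y, β y := by
    intro k
    induction k with
    | zero => exact fun _ => ⟨∅, Y₀, rfl, subset_rfl, by simp, by simpa using hbase⟩
    | succ k ih =>
      intro hk
      obtain ⟨Z, Y, hZ, hYY, hZY, hb⟩ := ih (by omega)
      set b := ∑ y ∈ Y, β y with hbdef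
      have hbpos : 0 < b := lt_of_lt_of_le (by positivity) hb
      have hkc : (k : ℝ) * c ≤ η / 8 := by
        calc (k : ℝ) * c ≤ s * c :=
              mul_le_mul_of_nonneg_right (Nat.cast_le.2 (by omega)) hc0.le
          _ = (η / 8) ^ s * (η / 8) := hsc
          _ ≤ 1 * (η / 8) := mul_le_mul_of_nonneg_right
              (pow_le_one₀ (by positivity) (by linarith)) (by positivity)
          _ = η / 8 := one_mul _
      -- Excluding the vertices already chosen costs at most `k c ≤ η / 8` of the mass `η / 2`.
      have hlow : ∀ y ∈ Y, η / 4 ≤ ∑ z ∈ Zᶜ, α z * closeIndicator G z y := by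
        intro y hy
        have h1 : η / 2 ≤ f y := (Finset.mem_filter.1 (hYY hy)).2
        have h2 : ∑ z ∈ Z, α z * closeIndicator G z y ≤ k * c := by
          rw [← hZ, ← nsmul_eq_mul]
          exact Finset.sum_le_card_nsmul _ _ _ fun z _ =>
            (mul_le_of_le_one_right (hα z) (closeIndicator_le_one G z y)).trans (hαc z)
        have h3 := Finset.sum_add_sum_compl Z fun z => α z * closeIndicator G z y
        rw [hf] at h1
        linarith
      have hex : ∃ z ∈ Zᶜ, η / 8 * b ≤ ∑ y ∈ Y, β y * closeIndicator G z y := by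
        by_contra! hno
        have h1 : b * (η / 4) ≤ ∑ z ∈ Zᶜ, α z * ∑ y ∈ Y, β y * closeIndicator G z y := by
          calc b * (η / 4) = ∑ y ∈ Y, β y * (η / 4) := Finset.sum_mul ..
            _ ≤ ∑ y ∈ Y, β y * ∑ z ∈ Zᶜ, α z * closeIndicator G z y :=
              Finset.sum_le_sum fun y hy => mul_le_mul_of_nonneg_left (hlow y hy) (hβ y)
            _ = _ := by
              simp_rw [Finset.mul_sum]
              rw [Finset.sum_comm]
              exact Finset.sum_congr rfl fun z _ => Finset.sum_congr rfl fun y _ => by ring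
        have h2 : ∑ z ∈ Zᶜ, α z * ∑ y ∈ Y, β y * closeIndicator G z y
            ≤ ∑ z ∈ Zᶜ, α z * (η / 8 * b) :=
          Finset.sum_le_sum fun z hz => mul_le_mul_of_nonneg_left (hno z hz).le (hα z)
        have h3 : ∑ z ∈ Zᶜ, α z ≤ 1 := by
          rw [← hα1]
          exact Finset.sum_le_univ_sum_of_nonneg hα
        rw [← Finset.sum_mul] at h2
        have h4 := mul_le_mul_of_nonneg_right h3 (show 0 ≤ η / 8 * b by positivity)
        nlinarith [mul_pos hη hbpos]
      obtain ⟨z, hz, hzb⟩ := hex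
      classical
      refine ⟨insert z Z, Y.filter fun y => z = y ∨ G.Adj z y, ?_,
        (Finset.filter_subset _ _).trans hYY, ?_, ?_⟩
      · rw [Finset.card_insert_of_notMem (Finset.mem_compl.1 hz), hZ]
      · intro z' hz' y hy
        rw [Finset.mem_filter] at hy
        rcases Finset.mem_insert.1 hz' with rfl | h
        · exact hy.2
        · exact hZY z' h y hy.1
      · have h1 : ∑ y ∈ Y, β y * closeIndicator G z y
            = ∑ y ∈ Y.filter fun y => z = y ∨ G.Adj z y, β y := by
          rw [Finset.sum_filter]
          refine Finset.sum_congr rfl fun y _ => ?_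
          split_ifs with h
          · rw [closeIndicator_eq_one h, mul_one]
          · rw [closeIndicator_eq_zero h, mul_zero]
        rw [← h1]
        refine le_trans ?_ hzb
        rw [pow_succ']
        calc η / 8 * (η / 8) ^ k * (η / 2) = η / 8 * ((η / 8) ^ k * (η / 2)) := by ring
          _ ≤ η / 8 * b := mul_le_mul_of_nonneg_left hb (by positivity)
  obtain ⟨Z, Y, hZ, -, hZY, hb⟩ := key s le_rfl
  have hY := card_lt_of_completeBipartiteGraph_free hG hZ hZY
  -- Fewer than `2 s` atoms of mass at most `c` total at most `2 s c = (η / 8)^s * η / 4`, half of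
  -- what `hb` demands.
  have h1 : ∑ y ∈ Y, β y ≤ Y.card * c := by
    rw [← nsmul_eq_mul]
    exact Finset.sum_le_card_nsmul _ _ _ fun y _ => hβc y
  have h2 : (Y.card : ℝ) * c ≤ (2 * s : ℝ) * c :=
    mul_le_mul_of_nonneg_right (by exact_mod_cast hY.le) hc0.le
  have h3 : 0 < (η / 8) ^ s * η := by positivity
  nlinarith

/-- As `sum_closeIndicator_le`, for unnormalized weights and with an error term in place of the
bound on the atoms. -/
theorem sum_closeIndicator_le_add {V : Type*} [Fintype V] [DecidableEq V]
    {G : SimpleGraph V} {s : ℕ} (hs : 0 < s)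
    (hG : (completeBipartiteGraph (Fin s) (Fin s)).Free G)
    {α β : V → ℝ} (hα : ∀ z, 0 ≤ α z) (hβ : ∀ z, 0 ≤ β z) {w : ℝ} (hα1 : ∑ z, α z = w)
    (hβ1 : ∑ z, β z = w) {η c : ℝ} (hη : 0 < η) (hη1 : η ≤ 1)
    (hc : c = (η / 8) ^ s * η / (8 * s)) :
    ∑ z, ∑ y, closeIndicator G z y * (α z * β y)
      ≤ η * w ^ 2 + (∑ z, α z ^ 2 + ∑ z, β z ^ 2) / c ^ 2 := by
  have hs' : (0 : ℝ) < s := Nat.cast_pos.2 hs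
  have hc0 : 0 < c := by rw [hc]; positivity
  have hw0 : 0 ≤ w := by rw [← hα1]; exact Finset.sum_nonneg fun z _ => hα z
  have hA : 0 ≤ ∑ z, α z ^ 2 := Finset.sum_nonneg fun z _ => sq_nonneg _
  have hB : 0 ≤ ∑ z, β z ^ 2 := Finset.sum_nonneg fun z _ => sq_nonneg _
  have htriv : ∑ z, ∑ y, closeIndicator G z y * (α z * β y) ≤ w ^ 2 := by
    calc _ ≤ ∑ z, ∑ y, α z * β y := Finset.sum_le_sum fun z _ => Finset.sum_le_sum fun y _ =>
          mul_le_of_le_one_left (mul_nonneg (hα z) (hβ y)) (closeIndicator_le_one G z y)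
      _ = w ^ 2 := by rw [← Finset.sum_mul_sum, hα1, hβ1, sq]
  -- One atom above `c w` makes the error term exceed the trivial bound `w^2`.
  have hatom : ∀ γ : V → ℝ, (∃ z, c * w < γ z) → w ^ 2 ≤ (∑ z, γ z ^ 2) / c ^ 2 := by
    rintro γ ⟨z, hz⟩
    rw [le_div_iff₀ (by positivity)]
    calc w ^ 2 * c ^ 2 = (c * w) ^ 2 := by ring
      _ ≤ γ z ^ 2 := pow_le_pow_left₀ (by positivity) hz.le 2
      _ ≤ _ := Finset.single_le_sum (f := fun z => γ z ^ 2) (fun z _ => sq_nonneg _)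
          (Finset.mem_univ z)
  have hw2 : 0 ≤ η * w ^ 2 := by positivity
  by_cases h1 : ∃ z, c * w < α z
  · have := hatom α h1
    rw [add_div]
    have : 0 ≤ (∑ z, β z ^ 2) / c ^ 2 := by positivity
    linarith
  by_cases h2 : ∃ z, c * w < β z
  · have := hatom β h2
    rw [add_div]
    have : 0 ≤ (∑ z, α z ^ 2) / c ^ 2 := by positivity
    linarith
  push Not at h1 h2
  refine le_trans ?_ (le_add_of_nonneg_right (by positivity))
  rcases hw0.eq_or_lt with hw | hw
  · rw [← hw] at htriv ⊢
    linarith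
  · have := sum_closeIndicator_le hs hG (α := fun z => α z / w) (β := fun z => β z / w)
      (fun z => div_nonneg (hα z) hw0) (fun z => div_nonneg (hβ z) hw0)
      (by rw [← Finset.sum_div, hα1, div_self hw.ne'])
      (by rw [← Finset.sum_div, hβ1, div_self hw.ne']) hη hη1 hc
      (fun z => by rw [div_le_iff₀ hw]; exact h1 z) (fun z => by rw [div_le_iff₀ hw]; exact h2 z)
    have h3 : ∑ z, ∑ y, closeIndicator G z y * (α z * β y)
        = (∑ z, ∑ y, closeIndicator G z y * (α z / w * (β y / w))) * w ^ 2 := by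
      simp_rw [Finset.sum_mul]
      refine Finset.sum_congr rfl fun z _ => Finset.sum_congr rfl fun y _ => ?_
      field_simp
    rw [h3]
    exact mul_le_mul_of_nonneg_right this (by positivity)

/-! ### Greedy selection of conflict-free elements -/

/-- A greedy selection of `t` elements that are pairwise not in conflict. -/
theorem exists_pairwise_lt_one {X : Type*} [Fintype X] [DecidableEq X] {W : X → ℝ}
    (hW : ∀ p, 0 ≤ W p) {b : X → X → ℝ} (hb : ∀ p q, 0 ≤ b p q) (hsymm : ∀ p q, b p q = b q p)
    (hrefl : ∀ p, 1 ≤ b p p) {t : ℕ} (ht : 0 < t) {w : ℝ} (hw : ∑ p, W p = w)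
    (hbad : ∑ p, ∑ q, W p * W q * b p q < w ^ 2 / (4 * t)) :
    ∃ f : Fin t → X, (∀ a, 0 < W (f a)) ∧ ∀ a a', a ≠ a' → b (f a) (f a') < 1 := by
  have ht' : (0 : ℝ) < t := Nat.cast_pos.2 ht
  have hbad0 : 0 ≤ ∑ p, ∑ q, W p * W q * b p q := Finset.sum_nonneg fun p _ =>
    Finset.sum_nonneg fun q _ => mul_nonneg (mul_nonneg (hW p) (hW q)) (hb p q)
  have hw0 : 0 < w := by
    have h0 : 0 ≤ w := by rw [← hw]; exact Finset.sum_nonneg fun p _ => hW p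
    rcases h0.eq_or_lt with h | h
    · rw [← h] at hbad
      simp only [ne_eq, OfNat.ofNat_ne_zero, not_false_eq_true, zero_pow, zero_div] at hbad
      exact absurd hbad hbad0.not_gt
    · exact h
  set D : X → ℝ := fun p => ∑ q, W q * b p q with hD
  have hD0 : ∀ p, 0 ≤ D p := fun p => Finset.sum_nonneg fun q _ => mul_nonneg (hW q) (hb p q)
  have hsum : ∑ p, ∑ q, W p * W q * b p q = ∑ p, W p * D p := by
    refine Finset.sum_congr rfl fun p _ => ?_
    rw [hD, Finset.mul_sum]
    exact Finset.sum_congr rfl fun q _ => by ring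
  rw [hsum] at hbad
  -- Requiring `D p < w / (2 t)` ensures that each chosen element rules out little weight later.
  have key : ∀ k ≤ t, ∃ I : Finset X, I.card = k ∧ (∀ p ∈ I, 0 < W p ∧ D p < w / (2 * t)) ∧
      ∀ p ∈ I, ∀ q ∈ I, p ≠ q → b p q < 1 := by
    intro k
    induction k with
    | zero => exact fun _ => ⟨∅, by simp⟩
    | succ k ih =>
      intro hk
      obtain ⟨I, hI, hIW, hIb⟩ := ih (by omega)
      have hex : ∃ q, 0 < W q ∧ D q < w / (2 * t) ∧ ∀ p ∈ I, b p q < 1 := by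
        by_contra! hno
        -- If no `q` is available, each weight is charged either to a large `D q` (less than `w / 2`
        -- in total, by Markov) or to a conflict with a chosen `p` (at most `w / 2` over fewer than
        -- `t` elements).
        have hpt : ∀ q, W q ≤ 2 * t / w * (W q * D q) + ∑ p ∈ I, W q * b p q := by
          intro q
          have h1 : 0 ≤ 2 * t / w * (W q * D q) :=
            mul_nonneg (by positivity) (mul_nonneg (hW q) (hD0 q))
          have h2 : ∀ p ∈ I, 0 ≤ W q * b p q := fun p _ => mul_nonneg (hW q) (hb p q)
          rcases (hW q).eq_or_lt with h | h
          · rw [← h]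
            simp
          · rcases lt_or_ge (D q) (w / (2 * t)) with h' | h'
            · obtain ⟨p, hp, hpq⟩ := hno q h h'
              calc W q ≤ W q * b p q := le_mul_of_one_le_right h.le hpq
                _ ≤ ∑ p ∈ I, W q * b p q :=
                  Finset.single_le_sum (f := fun p => W q * b p q) h2 hp
                _ ≤ _ := le_add_of_nonneg_left h1
            · refine le_trans ?_ (le_add_of_nonneg_right (Finset.sum_nonneg h2))
              calc W q = 2 * t / w * (W q * (w / (2 * t))) := by field_simp
                _ ≤ _ := mul_le_mul_of_nonneg_left (mul_le_mul_of_nonneg_left h' h.le)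
                    (by positivity)
        have h1 : w ≤ 2 * t / w * ∑ q, W q * D q + ∑ p ∈ I, D p := by
          calc w = ∑ q, W q := hw.symm
            _ ≤ ∑ q, (2 * t / w * (W q * D q) + ∑ p ∈ I, W q * b p q) :=
              Finset.sum_le_sum fun q _ => hpt q
            _ = _ := by rw [Finset.sum_add_distrib, ← Finset.mul_sum, Finset.sum_comm]
        have h2 : 2 * t / w * ∑ q, W q * D q < w / 2 := by
          calc 2 * t / w * ∑ q, W q * D q < 2 * t / w * (w ^ 2 / (4 * t)) :=
                mul_lt_mul_of_pos_left hbad (by positivity)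
            _ = w / 2 := by field_simp; norm_num
        have h3 : ∑ p ∈ I, D p ≤ w / 2 := by
          calc ∑ p ∈ I, D p ≤ I.card • (w / (2 * t)) :=
                Finset.sum_le_card_nsmul _ _ _ fun p hp => (hIW p hp).2.le
            _ = k * (w / (2 * t)) := by rw [nsmul_eq_mul, hI]
            _ ≤ t * (w / (2 * t)) :=
              mul_le_mul_of_nonneg_right (Nat.cast_le.2 (by omega)) (by positivity)
            _ = w / 2 := by field_simp
        linarith
      obtain ⟨q, hq, hqD, hqI⟩ := hex
      refine ⟨insert q I, ?_, ?_, ?_⟩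
      -- Self-conflict at least `1` forces `q` to be new.
      · rw [Finset.card_insert_of_notMem fun h => (hqI q h).not_ge (hrefl q), hI]
      · intro p hp
        rcases Finset.mem_insert.1 hp with rfl | hp
        · exact ⟨hq, hqD⟩
        · exact hIW p hp
      · intro p hp p' hp' hne
        rcases Finset.mem_insert.1 hp with rfl | hpI <;>
          rcases Finset.mem_insert.1 hp' with rfl | hpI'
        · exact absurd rfl hne
        · rw [hsymm]; exact hqI _ hpI'
        · exact hqI _ hpI
        · exact hIb _ hpI _ hpI' hne
  obtain ⟨I, hI, hIW, hIb⟩ := key t le_rfl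
  let e := (I.equivFinOfCardEq hI).symm
  exact ⟨fun a => e a, fun a => (hIW _ (e a).2).1, fun a a' h => hIb _ (e a).2 _ (e a').2
    fun h' => h (e.injective (Subtype.ext h'))⟩

/-! ### From paths to an induced theta graph -/

theorem close_comm {V : Type*} {G : SimpleGraph V} {x y : V} :
    (x = y ∨ G.Adj x y) ↔ (y = x ∨ G.Adj y x) := by
  rw [eq_comm, G.adj_comm]

/-- Induced paths with common ends and no further coincidences or adjacencies form an induced theta
graph. -/
theorem thetaGraph_isIndContained_of_paths {V : Type*} {G : SimpleGraph V} {ℓ t : ℕ} (hℓ : 2 ≤ ℓ)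
    (ht : 0 < t) {u v : V} (P : Fin t → ℕ → V) (h0 : ∀ a, P a 0 = u) (h1 : ∀ a, P a ℓ = v)
    (hadj : ∀ a, ∀ i < ℓ, G.Adj (P a i) (P a (i + 1)))
    (hin : ∀ a i j, i + 2 ≤ j → j ≤ ℓ → ¬ (P a i = P a j ∨ G.Adj (P a i) (P a j)))
    (hcr : ∀ a b i j, a ≠ b → 0 < i → i < ℓ → 0 < j → j < ℓ →
      ¬ (P a i = P b j ∨ G.Adj (P a i) (P b j))) :
    (thetaGraph ℓ t).IsIndContained G := by
  let f : ThetaVertex ℓ t → V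
    | Sum.inl false => u
    | Sum.inl true => v
    | Sum.inr (i, j) => P i (j + 1)
  have hstep : ∀ x y, ThetaStep ℓ t x y → G.Adj (f x) (f y) := by
    rintro ((_ | _) | ⟨i, j⟩) ((_ | _) | ⟨i', j'⟩) h
    · exact h.elim
    · exact h.elim
    · have hj : (j' : ℕ) = 0 := h
      have := hadj i' 0 (by omega)
      rw [h0] at this
      simpa only [f, hj] using this
    · exact h.elim
    · exact h.elim
    · exact h.elim
    · exact h.elim
    · have hj : (j : ℕ) + 2 = ℓ := h
      have := hadj i (j + 1) (by omega)
      rw [show (j : ℕ) + 1 + 1 = ℓ by omega, h1] at this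
      exact this
    · obtain ⟨rfl, hj⟩ : i = i' ∧ (j : ℕ) + 1 = j' := h
      have := hadj i (j + 1) (by omega)
      rw [show (j : ℕ) + 1 + 1 = j' + 1 by omega] at this
      exact this
  have huv : ¬ (u = v ∨ G.Adj u v) := by
    have := hin ⟨0, ht⟩ 0 ℓ (by omega) le_rfl
    rwa [h0, h1] at this
  have hu : ∀ (i : Fin t) (j : Fin (ℓ - 1)), (j : ℕ) ≠ 0 →
      ¬ (u = P i (j + 1) ∨ G.Adj u (P i (j + 1))) := by
    intro i j hj
    have := hin i 0 (j + 1) (by omega) (by omega)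
    rwa [h0] at this
  have hv : ∀ (i : Fin t) (j : Fin (ℓ - 1)), (j : ℕ) + 2 ≠ ℓ →
      ¬ (P i (j + 1) = v ∨ G.Adj (P i (j + 1)) v) := by
    intro i j hj
    have := hin i (j + 1) ℓ (by omega) le_rfl
    rwa [h1] at this
  -- Excluding equality together with adjacency serves both injectivity and inducedness.
  have hnon : ∀ x y, x ≠ y → ¬ ThetaStep ℓ t x y → ¬ ThetaStep ℓ t y x →
      ¬ (f x = f y ∨ G.Adj (f x) (f y)) := by
    rintro ((_ | _) | ⟨i, j⟩) ((_ | _) | ⟨i', j'⟩) hne hxy hyx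
    · exact absurd rfl hne
    · exact huv
    · exact hu i' j' hxy
    · exact fun h => huv (close_comm.1 h)
    · exact absurd rfl hne
    · exact fun h => hv i' j' hyx (close_comm.1 h)
    · exact fun h => hu i j hyx (close_comm.1 h)
    · exact hv i j hxy
    · by_cases hi : i = i'
      · subst hi
        have hjj : (j : ℕ) ≠ j' := fun h => hne (by rw [Fin.ext h])
        have h3 : (j : ℕ) + 1 ≠ j' := fun h => hxy ⟨rfl, h⟩
        have h4 : (j' : ℕ) + 1 ≠ j := fun h => hyx ⟨rfl, h⟩
        rcases lt_or_gt_of_ne hjj with h | h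
        · exact hin i (j + 1) (j' + 1) (by omega) (by omega)
        · exact fun hc => hin i (j' + 1) (j + 1) (by omega) (by omega) (close_comm.1 hc)
      · exact hcr i i' (j + 1) (j' + 1) hi (by omega) (by omega) (by omega) (by omega)
  have hT : ∀ x y, (thetaGraph ℓ t).Adj x y ↔ x ≠ y ∧ (ThetaStep ℓ t x y ∨ ThetaStep ℓ t y x) :=
    fun x y => SimpleGraph.fromRel_adj _ _ _
  have hfwd : ∀ x y, (ThetaStep ℓ t x y ∨ ThetaStep ℓ t y x) → G.Adj (f x) (f y) :=
    fun x y h => h.elim (hstep x y) fun h => (hstep y x h).symm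
  have hinj : Function.Injective f := by
    intro x y hxy
    by_contra hne
    by_cases h : ThetaStep ℓ t x y ∨ ThetaStep ℓ t y x
    · exact (hfwd x y h).ne hxy
    · push Not at h
      exact hnon x y hne h.1 h.2 (Or.inl hxy)
  refine ⟨⟨⟨f, hinj⟩, ?_⟩⟩
  intro x y
  rw [hT]
  constructor
  · intro h
    have hne : x ≠ y := fun hxy => G.irrefl (hxy ▸ h : G.Adj (f x) (f x))
    refine ⟨hne, ?_⟩
    by_contra hc
    push Not at hc
    exact hnon x y hne hc.1 hc.2 (Or.inr h)
  · exact fun h => hfwd x y h.2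

/-! ### Two marked vertices on a closed walk -/

theorem sum_comm_pairs {V : Type*} [Fintype V] (f : V → V → V → V → ℝ) :
    ∑ z, ∑ y, ∑ u, ∑ v, f z y u v = ∑ u, ∑ v, ∑ z, ∑ y, f z y u v := by
  calc ∑ z, ∑ y, ∑ u, ∑ v, f z y u v = ∑ z, ∑ u, ∑ v, ∑ y, f z y u v := by
        refine Finset.sum_congr rfl fun z _ => ?_
        rw [Finset.sum_comm]
        exact Finset.sum_congr rfl fun u _ => Finset.sum_comm
    _ = ∑ u, ∑ z, ∑ v, ∑ y, f z y u v := Finset.sum_comm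
    _ = _ := Finset.sum_congr rfl fun u _ => Finset.sum_comm

/-- Summing out the ends `u` and `v` merges the four pieces of the closed walk into two arcs between
`z` and `y`, of lengths `i + k` and `j + l`. -/
theorem sum_pair_opposite {V : Type*} [Fintype V] [DecidableEq V]
    {M : Matrix V V ℝ} (hM : M.IsHermitian) (F : V → V → ℝ) (i j k l : ℕ) :
    ∑ u, ∑ v, ∑ z, ∑ y, F z y * (((M ^ i) u z * (M ^ j) z v) * ((M ^ k) u y * (M ^ l) y v))
      = ∑ z, ∑ y, F z y * ((M ^ (i + k)) z y * (M ^ (j + l)) z y) := by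
  rw [← sum_comm_pairs]
  refine Finset.sum_congr rfl fun z _ => Finset.sum_congr rfl fun y _ => ?_
  rw [Matrix.pow_add_apply_symm hM i k, pow_add M j l, Matrix.mul_apply, Finset.sum_mul_sum,
    Finset.mul_sum]
  refine Finset.sum_congr rfl fun u _ => ?_
  rw [Finset.mul_sum]
  refine Finset.sum_congr rfl fun v _ => ?_
  rw [Matrix.pow_apply_comm_of_symm hM l v y]
  ring

/-- Here one arc is the stretch of length `g` between the marked vertices, and the other passes
through `u` and `v`. The result has the same shape as for opposite vertices, so only the arc lengths
matter. -/
theorem sum_pair_same_side {V : Type*} [Fintype V] [DecidableEq V]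
    {M : Matrix V V ℝ} (hM : M.IsHermitian) (F : V → V → ℝ) (i g k l : ℕ) :
    ∑ u, ∑ v, (M ^ l) u v * ∑ y, ∑ z, F y z * ((M ^ i) u y * (M ^ g) y z * (M ^ k) z v)
      = ∑ y, ∑ z, F y z * ((M ^ g) y z * (M ^ (i + (l + k))) y z) := by
  simp_rw [Finset.mul_sum]
  rw [← sum_comm_pairs]
  refine Finset.sum_congr rfl fun y _ => Finset.sum_congr rfl fun z _ => ?_
  rw [Matrix.pow_add_apply_symm hM i, Finset.mul_sum, Finset.mul_sum]
  refine Finset.sum_congr rfl fun u _ => ?_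
  rw [pow_add M l k, Matrix.mul_apply, Finset.mul_sum, Finset.mul_sum, Finset.mul_sum]
  refine Finset.sum_congr rfl fun v _ => ?_
  rw [Matrix.pow_apply_comm_of_symm hM k v z]
  ring

theorem sum_pow_mul_pow {V : Type*} [Fintype V] [DecidableEq V]
    (M : Matrix V V ℝ) (i j : ℕ) (u v : V) :
    ∑ z, (M ^ i) u z * (M ^ j) z v = (M ^ (i + j)) u v := by
  rw [pow_add, Matrix.mul_apply]

theorem trace_pow_two_mul {V : Type*} [Fintype V] [DecidableEq V]
    {M : Matrix V V ℝ} (hM : M.IsHermitian) (l : ℕ) :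
    ∑ u, ∑ v, (M ^ l) u v ^ 2 = ∑ z, (M ^ (2 * l)) z z := by
  refine Finset.sum_congr rfl fun u _ => ?_
  rw [two_mul, pow_add, Matrix.mul_apply]
  exact Finset.sum_congr rfl fun v _ => by rw [Matrix.pow_apply_comm_of_symm hM l v u, sq]

/-- In a `K_{s,s}`-free graph of large minimum degree, a random weighted closed walk of length `2 ℓ`
is unlikely to have a given pair of opposite vertices coincident or adjacent. -/
theorem sum_close_opposite_le {V : Type*} [Fintype V] [DecidableEq V] [Nonempty V]
    (G : SimpleGraph V) [DecidableRel G.Adj] {s : ℕ} (hs : 0 < s)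
    (hG : (completeBipartiteGraph (Fin s) (Fin s)).Free G)
    {δ N : ℝ} (hδ : 0 < δ) (hd : ∀ x, δ ≤ G.degree x) {ℓ : ℕ}
    (hN : 0 < N) (hNV : N ^ ℓ = Fintype.card V) {η c : ℝ} (hη : 0 < η) (hη1 : η ≤ 1)
    (hc : c = (η / 8) ^ s * η / (8 * s)) (hε : 4 * N / δ ≤ η * c ^ 2)
    {i j : ℕ} (hi : 0 < i) (hiℓ : i < ℓ) (hj : 0 < j) (hjℓ : j < ℓ) :
    ∑ u, ∑ v, ∑ z, ∑ y, closeIndicator G z y *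
        (((normalizedAdjMatrix G ^ i) u z * (normalizedAdjMatrix G ^ (ℓ - i)) z v) *
          ((normalizedAdjMatrix G ^ j) u y * (normalizedAdjMatrix G ^ (ℓ - j)) y v))
      ≤ 2 * η * ∑ z, (normalizedAdjMatrix G ^ (2 * ℓ)) z z := by
  have hs' : (0 : ℝ) < s := Nat.cast_pos.2 hs
  have hc0 : 0 < c := by rw [hc]; positivity
  have hM := normalizedAdjMatrix_isHermitian G
  have hM0 := Matrix.pow_apply_nonneg (normalizedAdjMatrix_nonneg G)
  have hcoll : ∀ i, 0 < i → i < ℓ → ∑ u, ∑ v, ∑ z, ((normalizedAdjMatrix G ^ i) u z *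
      (normalizedAdjMatrix G ^ (ℓ - i)) z v) ^ 2
      ≤ 2 * N / δ * ∑ z, (normalizedAdjMatrix G ^ (2 * ℓ)) z z := by
    intro i hi hiℓ
    have h := sum_sq_normalizedAdjMatrix_pow_le G hδ hd (i - 1) (ℓ - i - 1) hN
      (by rw [show i - 1 + (ℓ - i - 1) + 2 = ℓ by omega, hNV])
    rwa [show i - 1 + (ℓ - i - 1) + 2 = ℓ by omega, show i - 1 + 1 = i by omega,
      show ℓ - i - 1 + 1 = ℓ - i by omega] at h
  have hT : 0 ≤ ∑ z, (normalizedAdjMatrix G ^ (2 * ℓ)) z z :=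
    Finset.sum_nonneg fun z _ => hM0 _ z z
  -- For each pair of ends, both laws have total mass `(M^ℓ) u v`; their squared atoms sum to
  -- collision weights.
  calc _ ≤ ∑ u, ∑ v, (η * (normalizedAdjMatrix G ^ ℓ) u v ^ 2 +
          (∑ z, ((normalizedAdjMatrix G ^ i) u z * (normalizedAdjMatrix G ^ (ℓ - i)) z v) ^ 2 +
            ∑ z, ((normalizedAdjMatrix G ^ j) u z * (normalizedAdjMatrix G ^ (ℓ - j)) z v) ^ 2)
              / c ^ 2) := by
        refine Finset.sum_le_sum fun u _ => Finset.sum_le_sum fun v _ => ?_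
        refine sum_closeIndicator_le_add hs hG (fun z => mul_nonneg (hM0 _ _ _) (hM0 _ _ _))
          (fun z => mul_nonneg (hM0 _ _ _) (hM0 _ _ _)) ?_ ?_ hη hη1 hc
        · rw [sum_pow_mul_pow, Nat.add_sub_cancel' hiℓ.le]
        · rw [sum_pow_mul_pow, Nat.add_sub_cancel' hjℓ.le]
    _ = η * ∑ z, (normalizedAdjMatrix G ^ (2 * ℓ)) z z +
          (∑ u, ∑ v, ∑ z, ((normalizedAdjMatrix G ^ i) u z *
            (normalizedAdjMatrix G ^ (ℓ - i)) z v) ^ 2 +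
          ∑ u, ∑ v, ∑ z, ((normalizedAdjMatrix G ^ j) u z *
            (normalizedAdjMatrix G ^ (ℓ - j)) z v) ^ 2) / c ^ 2 := by
        simp_rw [Finset.sum_add_distrib, ← Finset.mul_sum, ← Finset.sum_div,
          Finset.sum_add_distrib, trace_pow_two_mul hM]
    _ ≤ η * ∑ z, (normalizedAdjMatrix G ^ (2 * ℓ)) z z +
          (2 * N / δ * ∑ z, (normalizedAdjMatrix G ^ (2 * ℓ)) z z +
            2 * N / δ * ∑ z, (normalizedAdjMatrix G ^ (2 * ℓ)) z z) / c ^ 2 := by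
        gcongr
        · exact hcoll i hi hiℓ
        · exact hcoll j hj hjℓ
    _ = η * ∑ z, (normalizedAdjMatrix G ^ (2 * ℓ)) z z +
          (4 * N / δ) / c ^ 2 * ∑ z, (normalizedAdjMatrix G ^ (2 * ℓ)) z z := by ring
    _ ≤ η * ∑ z, (normalizedAdjMatrix G ^ (2 * ℓ)) z z +
          η * ∑ z, (normalizedAdjMatrix G ^ (2 * ℓ)) z z := by
        gcongr
        rwa [div_le_iff₀ (by positivity)]
    _ = _ := by ring

/-! ### Conflicts between walks -/

/-- The number of unwanted coincidences and adjacencies in the union of two walks with the same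
ends. -/
noncomputable def walkConflict {V : Type*} (G : SimpleGraph V) {ℓ : ℕ}
    (p q : Fin (ℓ + 1) → V) : ℝ :=
  ∑ i : Fin (ℓ + 1), ∑ j : Fin (ℓ + 1),
    ((if (0 < (i : ℕ) ∧ (i : ℕ) < ℓ) ∧ 0 < (j : ℕ) ∧ (j : ℕ) < ℓ then
        closeIndicator G (p i) (q j) else 0) +
      (if (i : ℕ) + 2 ≤ j then
        closeIndicator G (p i) (p j) + closeIndicator G (q i) (q j) else 0))

theorem sum_walkWeight_mul_opposite {V : Type*} [Fintype V] [DecidableEq V] (M : Matrix V V ℝ)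
    (n : ℕ) (u v : V) (i j : Fin (n + 1)) (F : V → V → ℝ) :
    ∑ p, ∑ q, walkWeight M n u v p * walkWeight M n u v q * F (p i) (q j)
      = ∑ z, ∑ y, F z y * (((M ^ (i : ℕ)) u z * (M ^ (n - i)) z v) *
          ((M ^ (j : ℕ)) u y * (M ^ (n - j)) y v)) := by
  calc _ = ∑ p, walkWeight M n u v p * ∑ q, walkWeight M n u v q * F (p i) (q j) := by
        simp_rw [Finset.mul_sum, mul_assoc]
    _ = ∑ p, walkWeight M n u v p *
          ∑ y, F (p i) y * ((M ^ (j : ℕ)) u y * (M ^ (n - j)) y v) := by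
        refine Finset.sum_congr rfl fun p _ => ?_
        rw [← sum_walkWeight_mul_apply M n u v j j.2]
    _ = _ := by
        rw [sum_walkWeight_mul_apply M n u v i i.2
          (fun z => ∑ y, F z y * ((M ^ (j : ℕ)) u y * (M ^ (n - j)) y v))]
        simp_rw [Finset.sum_mul]
        exact Finset.sum_congr rfl fun z _ => Finset.sum_congr rfl fun y _ => by ring

theorem closeIndicator_comm {V : Type*} (G : SimpleGraph V) (x y : V) :
    closeIndicator G x y = closeIndicator G y x := by
  by_cases h : x = y ∨ G.Adj x y
  · rw [closeIndicator_eq_one h, closeIndicator_eq_one (close_comm.1 h)]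
  · rw [closeIndicator_eq_zero h, closeIndicator_eq_zero fun h' => h (close_comm.1 h')]

theorem walkConflict_comm {V : Type*} (G : SimpleGraph V) {ℓ : ℕ} (p q : Fin (ℓ + 1) → V) :
    walkConflict G p q = walkConflict G q p := by
  unfold walkConflict
  simp_rw [Finset.sum_add_distrib]
  congr 1
  · rw [Finset.sum_comm]
    refine Finset.sum_congr rfl fun i _ => Finset.sum_congr rfl fun j _ => ?_
    rw [closeIndicator_comm G (p j) (q i)]
    exact if_congr and_comm rfl rfl
  · refine Finset.sum_congr rfl fun i _ => Finset.sum_congr rfl fun j _ => ?_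
    rw [add_comm (closeIndicator G (p i) (p j))]

theorem walkConflict_term_nonneg {V : Type*} (G : SimpleGraph V) {ℓ : ℕ}
    (p q : Fin (ℓ + 1) → V) (i j : Fin (ℓ + 1)) :
    0 ≤ (if (0 < (i : ℕ) ∧ (i : ℕ) < ℓ) ∧ 0 < (j : ℕ) ∧ (j : ℕ) < ℓ then
        closeIndicator G (p i) (q j) else 0) +
      (if (i : ℕ) + 2 ≤ j then
        closeIndicator G (p i) (p j) + closeIndicator G (q i) (q j) else 0) := by
  have := closeIndicator_nonneg G
  have h1 := this (p i) (q j)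
  have h2 := add_nonneg (this (p i) (p j)) (this (q i) (q j))
  split_ifs <;> linarith

theorem walkConflict_term_le {V : Type*} (G : SimpleGraph V) {ℓ : ℕ}
    (p q : Fin (ℓ + 1) → V) (i j : Fin (ℓ + 1)) :
    (if (0 < (i : ℕ) ∧ (i : ℕ) < ℓ) ∧ 0 < (j : ℕ) ∧ (j : ℕ) < ℓ then
        closeIndicator G (p i) (q j) else 0) +
      (if (i : ℕ) + 2 ≤ j then
        closeIndicator G (p i) (p j) + closeIndicator G (q i) (q j) else 0)
      ≤ walkConflict G p q := by
  refine le_trans ?_ (Finset.single_le_sum (fun i _ => Finset.sum_nonneg fun j _ =>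
    walkConflict_term_nonneg G p q i j) (Finset.mem_univ i))
  exact Finset.single_le_sum (fun j _ => walkConflict_term_nonneg G p q i j) (Finset.mem_univ j)

theorem walkConflict_nonneg {V : Type*} (G : SimpleGraph V) {ℓ : ℕ}
    (p q : Fin (ℓ + 1) → V) : 0 ≤ walkConflict G p q :=
  Finset.sum_nonneg fun i _ => Finset.sum_nonneg fun j _ => walkConflict_term_nonneg G p q i j

theorem not_close_of_closeIndicator_lt_one {V : Type*} {G : SimpleGraph V} {x y : V}
    (h : closeIndicator G x y < 1) : ¬ (x = y ∨ G.Adj x y) :=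
  fun hc => h.ne (closeIndicator_eq_one hc)

theorem not_close_opposite_of_walkConflict_lt_one {V : Type*} {G : SimpleGraph V} {ℓ : ℕ}
    {p q : Fin (ℓ + 1) → V} (h : walkConflict G p q < 1) {i j : Fin (ℓ + 1)}
    (hi : 0 < (i : ℕ)) (hiℓ : (i : ℕ) < ℓ) (hj : 0 < (j : ℕ)) (hjℓ : (j : ℕ) < ℓ) :
    ¬ (p i = q j ∨ G.Adj (p i) (q j)) := by
  refine not_close_of_closeIndicator_lt_one (lt_of_le_of_lt ?_ h)
  refine le_trans ?_ (walkConflict_term_le G p q i j)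
  rw [if_pos ⟨⟨hi, hiℓ⟩, hj, hjℓ⟩]
  have h2 := add_nonneg (closeIndicator_nonneg G (p i) (p j)) (closeIndicator_nonneg G (q i) (q j))
  split_ifs <;> linarith

theorem not_close_same_side_of_walkConflict_lt_one {V : Type*} {G : SimpleGraph V} {ℓ : ℕ}
    {p q : Fin (ℓ + 1) → V} (h : walkConflict G p q < 1) {i j : Fin (ℓ + 1)}
    (hij : (i : ℕ) + 2 ≤ j) : ¬ (p i = p j ∨ G.Adj (p i) (p j)) := by
  refine not_close_of_closeIndicator_lt_one (lt_of_le_of_lt ?_ h)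
  refine le_trans ?_ (walkConflict_term_le G p q i j)
  rw [if_pos hij]
  have h1 := closeIndicator_nonneg G (p i) (q j)
  have h2 := closeIndicator_nonneg G (q i) (q j)
  split_ifs <;> linarith

/-- Since `2 ≤ ℓ`, position `1` is internal and collides with itself. This keeps the greedily chosen
walks distinct. -/
theorem one_le_walkConflict_self {V : Type*} (G : SimpleGraph V) {ℓ : ℕ} (hℓ : 2 ≤ ℓ)
    (p : Fin (ℓ + 1) → V) : 1 ≤ walkConflict G p p := by
  by_contra! h
  exact not_close_opposite_of_walkConflict_lt_one h (i := ⟨1, by omega⟩) (j := ⟨1, by omega⟩)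
    one_pos (by exact hℓ) one_pos (by exact hℓ) (Or.inl rfl)

/-- Rotating the closed walk so that it starts one step after position `i` puts the marked vertices
on opposite sides, at distances `1` and `j - i - 1` from the new start. The gap of at least `2`
makes both positions internal. -/
theorem sum_walkWeight_mul_same_side {V : Type*} [Fintype V] [DecidableEq V] {M : Matrix V V ℝ}
    (hM : M.IsHermitian) (n : ℕ) {i j : Fin (n + 1)} (hij : (i : ℕ) + 2 ≤ j) (F : V → V → ℝ) :
    ∑ u, ∑ v, ∑ p, ∑ q, walkWeight M n u v p * walkWeight M n u v q * F (p i) (p j)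
      = ∑ u, ∑ v, ∑ z, ∑ y, F z y * (((M ^ 1) u z * (M ^ (n - 1)) z v) *
          ((M ^ ((j : ℕ) - i - 1)) u y * (M ^ (n - (j - i - 1))) y v)) := by
  have hj : (j : ℕ) ≤ n := Nat.lt_succ_iff.1 j.2
  rw [sum_pair_opposite hM, show 1 + ((j : ℕ) - i - 1) = j - i by omega,
    show n - 1 + (n - ((j : ℕ) - i - 1)) = i + (n + (n - j)) by omega,
    ← sum_pair_same_side hM F i (j - i) (n - j) n]
  refine Finset.sum_congr rfl fun u _ => Finset.sum_congr rfl fun v _ => ?_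
  have h := sum_walkWeight_mul_apply₂ M n u v i j (by omega) j.2 F
  simp only [Fin.eta] at h
  rw [← h, ← sum_walkWeight, Finset.sum_mul_sum, Finset.sum_comm]
  exact Finset.sum_congr rfl fun p _ => Finset.sum_congr rfl fun q _ => by ring

/-- Each of the `(ℓ + 1)^2` index pairs costs at most `κ` across the two walks and `κ` within each
of them. -/
theorem sum_walkConflict_le {V : Type*} [Fintype V] [DecidableEq V]
    (G : SimpleGraph V) {M : Matrix V V ℝ} (hM : M.IsHermitian) {ℓ : ℕ} {κ : ℝ} (hκ0 : 0 ≤ κ)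
    (hκ : ∀ i j : ℕ, 0 < i → i < ℓ → 0 < j → j < ℓ → ∑ u, ∑ v, ∑ z, ∑ y, closeIndicator G z y *
        (((M ^ i) u z * (M ^ (ℓ - i)) z v) * ((M ^ j) u y * (M ^ (ℓ - j)) y v)) ≤ κ) :
    ∑ u, ∑ v, ∑ p, ∑ q, walkWeight M ℓ u v p * walkWeight M ℓ u v q * walkConflict G p q
      ≤ 3 * (ℓ + 1) ^ 2 * κ := by
  set S : ((Fin (ℓ + 1) → V) → (Fin (ℓ + 1) → V) → ℝ) → ℝ := fun f =>
    ∑ u, ∑ v, ∑ p, ∑ q, walkWeight M ℓ u v p * walkWeight M ℓ u v q * f p q with hS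
  have hadd : ∀ f g, S (fun p q => f p q + g p q) = S f + S g := fun f g => by
    simp only [hS, mul_add, Finset.sum_add_distrib]
  have hzero : S (fun _ _ => 0) = 0 := by simp [hS]
  have hsum : ∀ f : Fin (ℓ + 1) → (Fin (ℓ + 1) → V) → (Fin (ℓ + 1) → V) → ℝ,
      S (fun p q => ∑ i, f i p q) = ∑ i, S (f i) := fun f => by
    simp only [hS, Finset.mul_sum]
    rw [Finset.sum_comm]
    refine Finset.sum_comm.trans ?_
    symm
    rw [Finset.sum_comm]
    refine Finset.sum_congr rfl fun u _ => ?_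
    rw [Finset.sum_comm]
    refine Finset.sum_congr rfl fun v _ => ?_
    rw [Finset.sum_comm]
    refine Finset.sum_congr rfl fun p _ => ?_
    rw [Finset.sum_comm]
  have h1 : ∀ i j : Fin (ℓ + 1), S (fun p q =>
      if (0 < (i : ℕ) ∧ (i : ℕ) < ℓ) ∧ 0 < (j : ℕ) ∧ (j : ℕ) < ℓ then
        closeIndicator G (p i) (q j) else 0) ≤ κ := by
    intro i j
    split_ifs with h
    · refine le_trans (le_of_eq ?_) (hκ i j h.1.1 h.1.2 h.2.1 h.2.2)
      exact Finset.sum_congr rfl fun u _ => Finset.sum_congr rfl fun v _ =>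
        sum_walkWeight_mul_opposite M ℓ u v i j _
    · rw [hzero]; exact hκ0
  have h2 : ∀ i j : Fin (ℓ + 1), (i : ℕ) + 2 ≤ j →
      S (fun p _ => closeIndicator G (p i) (p j)) ≤ κ := by
    intro i j h
    have hj : (j : ℕ) ≤ ℓ := Nat.lt_succ_iff.1 j.2
    refine le_trans (le_of_eq ?_)
      (hκ 1 (j - i - 1) one_pos (by omega) (by omega) (by omega))
    exact sum_walkWeight_mul_same_side hM ℓ h _
  have h3 : ∀ i j : Fin (ℓ + 1), (i : ℕ) + 2 ≤ j →
      S (fun _ q => closeIndicator G (q i) (q j)) ≤ κ := by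
    intro i j h
    refine le_trans (le_of_eq ?_) (h2 i j h)
    refine Finset.sum_congr rfl fun u _ => Finset.sum_congr rfl fun v _ => ?_
    rw [Finset.sum_comm]
    exact Finset.sum_congr rfl fun p _ => Finset.sum_congr rfl fun q _ => by ring
  have h4 : ∀ i j : Fin (ℓ + 1), S (fun p q => if (i : ℕ) + 2 ≤ j then
      closeIndicator G (p i) (p j) + closeIndicator G (q i) (q j) else 0) ≤ 2 * κ := by
    intro i j
    split_ifs with h
    · rw [hadd, two_mul]
      exact add_le_add (h2 i j h) (h3 i j h)
    · rw [hzero]; positivity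
  calc S (fun p q => walkConflict G p q) ≤ ∑ i : Fin (ℓ + 1), ∑ j : Fin (ℓ + 1), 3 * κ := by
        unfold walkConflict
        rw [hsum]
        refine Finset.sum_le_sum fun i _ => ?_
        rw [hsum]
        refine Finset.sum_le_sum fun j _ => ?_
        rw [hadd]
        linarith [h1 i j, h4 i j]
    _ = 3 * (ℓ + 1) ^ 2 * κ := by
        simp only [Finset.sum_const, Finset.card_univ, Fintype.card_fin, nsmul_eq_mul]
        push_cast
        ring

/-! ### Numerical estimates -/

/-- With `η = q^(-4) / 2` one has `η / 8 ≥ q^(-6)`, hence `c ≥ q^(-(7s+6))` and `η c^2 ≥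
q^(-(14s+17))`. The exponent `20 s + 16` leaves room to spare. -/
theorem four_div_pow_le {q : ℝ} (hq : 4 ≤ q) {s : ℕ} (hs : 2 ≤ s) :
    4 / q ^ (20 * s + 16) ≤ ((q ^ 4)⁻¹ / 2) *
      ((((q ^ 4)⁻¹ / 2) / 8) ^ s * ((q ^ 4)⁻¹ / 2) / (8 * s)) ^ 2 := by
  have hq0 : 0 < q := by linarith
  have hs0 : (0 : ℝ) < s := by exact_mod_cast (by omega : 0 < s)
  have h16 : (16 : ℝ) ≤ q ^ 2 := by nlinarith
  have hsq : (s : ℝ) ≤ q ^ s := by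
    calc (s : ℝ) ≤ (2 : ℝ) ^ s := by exact_mod_cast (Nat.lt_two_pow_self (n := s)).le
      _ ≤ q ^ s := pow_le_pow_left₀ (by norm_num) (by linarith) s
  have h1 : (q ^ 6)⁻¹ ≤ (q ^ 4)⁻¹ / 2 / 8 := by
    rw [show (q ^ 4)⁻¹ / 2 / 8 = (q ^ 4 * 16)⁻¹ by rw [mul_inv]; ring]
    refine inv_anti₀ (by positivity) ?_
    calc q ^ 4 * 16 ≤ q ^ 4 * q ^ 2 := by gcongr
      _ = q ^ 6 := by ring
  have h2 : (q ^ (7 * s + 6))⁻¹ ≤ (((q ^ 4)⁻¹ / 2) / 8) ^ s * ((q ^ 4)⁻¹ / 2) / (8 * s) := by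
    calc (q ^ (7 * s + 6))⁻¹ = ((q ^ 6)⁻¹) ^ s * (q ^ 4 * (q ^ 2 * q ^ s))⁻¹ := by
          rw [inv_pow, ← mul_inv, ← pow_mul]
          congr 1
          ring
      _ ≤ ((q ^ 4)⁻¹ / 2 / 8) ^ s * (q ^ 4 * (16 * s))⁻¹ := by
          refine mul_le_mul (pow_le_pow_left₀ (by positivity) h1 s) ?_ (by positivity)
            (by positivity)
          refine inv_anti₀ (by positivity) ?_
          gcongr
      _ = _ := by
          rw [mul_div_assoc]
          congr 1
          rw [mul_inv]
          field_simp
          norm_num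
  have h3 : (q ^ 5)⁻¹ ≤ (q ^ 4)⁻¹ / 2 := by
    rw [show (q ^ 4)⁻¹ / 2 = (q ^ 4 * 2)⁻¹ by rw [mul_inv]; ring]
    refine inv_anti₀ (by positivity) ?_
    calc q ^ 4 * 2 ≤ q ^ 4 * q := by gcongr; linarith
      _ = q ^ 5 := by ring
  calc 4 / q ^ (20 * s + 16) ≤ (q ^ (14 * s + 17))⁻¹ := by
        rw [div_le_iff₀ (by positivity), inv_mul_eq_div, le_div_iff₀ (by positivity)]
        calc 4 * q ^ (14 * s + 17) ≤ q * q ^ (14 * s + 17) := by gcongr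
          _ = q ^ (14 * s + 18) := by ring
          _ ≤ q ^ (20 * s + 16) := pow_le_pow_right₀ (by linarith) (by omega)
    _ = (q ^ 5)⁻¹ * ((q ^ (7 * s + 6))⁻¹) ^ 2 := by
        rw [inv_pow, ← mul_inv, ← pow_mul, ← pow_add]
        congr 2
        ring
    _ ≤ _ := mul_le_mul h3 (pow_le_pow_left₀ (by positivity) h2 2) (by positivity) (by positivity)

/-- The left side is the conflict fraction for `κ = 2 η T`, the right side the threshold of the
greedy selection. Using `(l + 1)^2 ≤ 9/4 * l^2`, it reduces to `27 < l^2 t^3`. -/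
theorem conflict_budget {l t : ℝ} (hl : 2 ≤ l) (ht : 2 ≤ t) :
    3 * (l + 1) ^ 2 * (2 * (((l * t) ^ 4)⁻¹ / 2)) < 1 / (4 * t) := by
  have hl0 : 0 < l := by linarith
  have ht0 : 0 < t := by linarith
  rw [lt_div_iff₀ (by positivity)]
  have h1 : (l + 1) ^ 2 ≤ 9 / 4 * l ^ 2 := by nlinarith
  have h2 : 27 < l ^ 2 * t ^ 3 := by
    have : (2 : ℝ) ^ 2 ≤ l ^ 2 := pow_le_pow_left₀ (by norm_num) hl 2
    have : (2 : ℝ) ^ 3 ≤ t ^ 3 := pow_le_pow_left₀ (by norm_num) ht 3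
    nlinarith
  have h3 : 0 < ((l * t) ^ 4)⁻¹ := by positivity
  calc 3 * (l + 1) ^ 2 * (2 * (((l * t) ^ 4)⁻¹ / 2)) * (4 * t)
      = 12 * t * ((l * t) ^ 4)⁻¹ * (l + 1) ^ 2 := by ring
    _ ≤ 12 * t * ((l * t) ^ 4)⁻¹ * (9 / 4 * l ^ 2) := by gcongr
    _ = 27 * (t * l ^ 2 * ((l * t) ^ 4)⁻¹) := by ring
    _ < l ^ 2 * t ^ 3 * (t * l ^ 2 * ((l * t) ^ 4)⁻¹) := by gcongr
    _ = 1 := by field_simp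

/-! ### The minimum degree case -/

/-- A `K_{s,s}`-free graph of large minimum degree contains an induced theta graph. -/
theorem thetaGraph_isIndContained_of_le_degree {ℓ t s : ℕ} (hℓ : 2 ≤ ℓ) (ht : 2 ≤ t) (hs : 2 ≤ s)
    {V : Type*} [Fintype V] [Nonempty V] (G : SimpleGraph V) [DecidableRel G.Adj]
    (hG : (completeBipartiteGraph (Fin s) (Fin s)).Free G)
    (hd : ∀ x, ((ℓ : ℝ) * t) ^ (20 * s + 16) * (Fintype.card V : ℝ) ^ (1 / (ℓ : ℝ))
      ≤ G.degree x) :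
    (thetaGraph ℓ t).IsIndContained G := by
  classical
  have hℓ2 : (2 : ℝ) ≤ ℓ := by exact_mod_cast hℓ
  have ht2 : (2 : ℝ) ≤ t := by exact_mod_cast ht
  have hq : 4 ≤ (ℓ : ℝ) * t := by nlinarith
  set q : ℝ := (ℓ : ℝ) * t with hqdef
  have hq0 : 0 < q := by linarith
  set N : ℝ := (Fintype.card V : ℝ) ^ (1 / (ℓ : ℝ)) with hNdef
  have hV : (0 : ℝ) < Fintype.card V := Nat.cast_pos.2 Fintype.card_pos
  have hN : 0 < N := Real.rpow_pos_of_pos hV _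
  have hNV : N ^ ℓ = Fintype.card V := by
    rw [hNdef, one_div, Real.rpow_inv_natCast_pow hV.le (by omega)]
  set δ : ℝ := q ^ (20 * s + 16) * N with hδdef
  have hδ : 0 < δ := by positivity
  set η : ℝ := (q ^ 4)⁻¹ / 2 with hηdef
  have hη : 0 < η := by positivity
  have hη1 : η ≤ 1 := by
    have : (q ^ 4)⁻¹ ≤ 1 := inv_le_one_of_one_le₀ (one_le_pow₀ (by linarith))
    linarith
  have hε : 4 * N / δ ≤ η * ((η / 8) ^ s * η / (8 * s)) ^ 2 := by
    refine le_trans (le_of_eq ?_) (four_div_pow_le hq hs)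
    rw [hδdef, mul_div_mul_right _ _ hN.ne']
  have hM := normalizedAdjMatrix_isHermitian G
  have hM0 := normalizedAdjMatrix_nonneg G
  set T := ∑ z, (normalizedAdjMatrix G ^ (2 * ℓ)) z z with hT
  have hTpos : 0 < T := zero_lt_one.trans_le (one_le_trace_normalizedAdjMatrix_pow G
    (fun x => Nat.cast_pos.1 (hδ.trans_le (hd x))) ℓ)
  have hconf := sum_walkConflict_le G hM (ℓ := ℓ) (κ := 2 * η * T) (by positivity)
    fun i j hi hiℓ hj hjℓ => sum_close_opposite_le G (by omega) hG hδ hd hN hNV hη hη1 rfl hε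
      hi hiℓ hj hjℓ
  have hlt : ∑ u, ∑ v, ∑ p, ∑ q, walkWeight (normalizedAdjMatrix G) ℓ u v p *
      walkWeight (normalizedAdjMatrix G) ℓ u v q * walkConflict G p q
      < ∑ u, ∑ v, (normalizedAdjMatrix G ^ ℓ) u v ^ 2 / (4 * t) := by
    refine hconf.trans_lt ?_
    simp_rw [← Finset.sum_div]
    rw [trace_pow_two_mul hM, ← hT]
    calc 3 * ((ℓ : ℝ) + 1) ^ 2 * (2 * η * T) = 3 * ((ℓ : ℝ) + 1) ^ 2 * (2 * η) * T := by ring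
      _ < 1 / (4 * t) * T := mul_lt_mul_of_pos_right (conflict_budget hℓ2 ht2) hTpos
      _ = T / (4 * t) := by ring
  -- Averaging yields a single pair of ends within the conflict threshold.
  obtain ⟨u, -, hu⟩ := Finset.exists_lt_of_sum_lt hlt
  obtain ⟨v, -, huv⟩ := Finset.exists_lt_of_sum_lt hu
  obtain ⟨f, hf, hff⟩ := exists_pairwise_lt_one
    (walkWeight_nonneg hM0 ℓ u v) (walkConflict_nonneg G) (walkConflict_comm G)
    (one_le_walkConflict_self G hℓ) (by omega : 0 < t)
    (sum_walkWeight (normalizedAdjMatrix G) ℓ u v) huv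
  have hends : ∀ a, f a 0 = u ∧ f a (Fin.last ℓ) = v := fun a => by
    by_contra h
    have := hf a
    rw [walkWeight, if_neg h] at this
    exact this.false
  have hstep : ∀ a, ∀ i : Fin ℓ, G.Adj (f a i.castSucc) (f a i.succ) := fun a i => by
    have := (hf a).ne'
    rw [walkWeight, if_pos (hends a)] at this
    exact adj_of_normalizedAdjMatrix_ne_zero G
      (Finset.prod_ne_zero_iff.1 this i (Finset.mem_univ i))
  -- Conflicts inside one walk are only recorded for pairs of walks, so a second walk is needed;
  -- this uses `2 ≤ t`.
  have hother : ∀ a : Fin t, ∃ b, a ≠ b := fun a => by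
    have : Nontrivial (Fin t) := Fin.nontrivial_iff_two_le.2 ht
    obtain ⟨b, hb⟩ := exists_ne a
    exact ⟨b, hb.symm⟩
  -- The default value `u` beyond position `ℓ` is never used.
  let P : Fin t → ℕ → V := fun a i => if h : i < ℓ + 1 then f a ⟨i, h⟩ else u
  have hP : ∀ a i (h : i < ℓ + 1), P a i = f a ⟨i, h⟩ := fun a i h => dif_pos h
  refine thetaGraph_isIndContained_of_paths hℓ (by omega) (u := u) (v := v) P ?_ ?_ ?_ ?_ ?_
  · intro a
    rw [hP a 0 (by omega)]
    exact (hends a).1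
  · intro a
    rw [hP a ℓ (by omega)]
    exact (hends a).2
  · intro a i hi
    rw [hP a i (by omega), hP a (i + 1) (by omega)]
    exact hstep a ⟨i, hi⟩
  · intro a i j hij hj
    obtain ⟨b, hb⟩ := hother a
    rw [hP a i (by omega), hP a j (by omega)]
    exact not_close_same_side_of_walkConflict_lt_one (hff a b hb) (by exact hij)
  · intro a b i j hab hi hiℓ hj hjℓ
    rw [hP a i (by omega), hP b j (by omega)]
    exact not_close_opposite_of_walkConflict_lt_one (hff a b hab) (by exact hi) (by exact hiℓ)
      (by exact hj) (by exact hjℓ)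

/-! ### Reduction to large minimum degree -/

/-- A graph with `e ≥ δ n` edges has a nonempty induced subgraph of minimum degree at least `δ`. -/
theorem exists_le_sum_adjMatrix {V : Type*} [Fintype V] [Nonempty V] [DecidableEq V]
    (G : SimpleGraph V) [DecidableRel G.Adj] {δ : ℝ}
    (h : δ * Fintype.card V ≤ G.edgeFinset.card) :
    ∃ S : Finset V, S.Nonempty ∧ ∀ x ∈ S, δ ≤ ∑ y ∈ S, G.adjMatrix ℝ x y := by
  set E : Finset V → ℝ := fun S => ∑ x ∈ S, ∑ y ∈ S, G.adjMatrix ℝ x y with hE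
  have huniv : 2 * δ * (Finset.univ : Finset V).card ≤ E Finset.univ := by
    have h1 : E Finset.univ = 2 * G.edgeFinset.card := by
      rw [hE]
      simp_rw [sum_adjMatrix_apply]
      exact_mod_cast G.sum_degrees_eq_twice_card_edges
    rw [h1, Finset.card_univ]
    linarith
  -- `E` counts each edge twice. In a smallest nonempty set with `E S ≥ 2 δ |S|`, deleting a vertex
  -- of degree below `δ` would preserve the inequality.
  obtain ⟨S, hS, hmin⟩ := Finset.exists_min_image
    (Finset.univ.filter fun S : Finset V => S.Nonempty ∧ 2 * δ * S.card ≤ E S) Finset.card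
    ⟨Finset.univ, Finset.mem_filter.2 ⟨Finset.mem_univ _, Finset.univ_nonempty, huniv⟩⟩
  obtain ⟨-, hSne, hSE⟩ := Finset.mem_filter.1 hS
  refine ⟨S, hSne, fun x hx => ?_⟩
  by_contra! hlt
  have hins : insert x (S.erase x) = S := Finset.insert_erase hx
  have hnot : x ∉ S.erase x := Finset.notMem_erase x S
  have hxx : G.adjMatrix ℝ x x = 0 := by simp
  have hdeg : ∑ y ∈ S, G.adjMatrix ℝ x y = ∑ y ∈ S.erase x, G.adjMatrix ℝ x y := by
    rw [← hins, Finset.sum_insert hnot, hxx, zero_add, hins]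
  have hsplit : E S = E (S.erase x) + 2 * ∑ y ∈ S, G.adjMatrix ℝ x y := by
    have hsw : ∑ y ∈ S.erase x, G.adjMatrix ℝ y x = ∑ y ∈ S.erase x, G.adjMatrix ℝ x y :=
      Finset.sum_congr rfl fun y _ => by simp only [SimpleGraph.adjMatrix_apply, G.adj_comm]
    calc E S = E (insert x (S.erase x)) := by rw [hins]
      _ = _ := by
        rw [hE]
        simp only [Finset.sum_insert hnot, Finset.sum_add_distrib, hxx, hsw, hdeg]
        ring
  have hcard : ((S.erase x).card : ℝ) = S.card - 1 := by
    rw [Finset.card_erase_of_mem hx, Nat.cast_sub (Finset.card_pos.2 hSne), Nat.cast_one]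
  have hEe : 2 * δ * (S.erase x).card < E (S.erase x) := by
    rw [hcard]
    linarith
  -- The inequality `hEe` is strict, so it fails for the empty set, where both sides vanish.
  have hne : (S.erase x).Nonempty := by
    rw [Finset.nonempty_iff_ne_empty]
    intro he
    rw [he] at hEe
    simp [hE] at hEe
  have := hmin _ (Finset.mem_filter.2 ⟨Finset.mem_univ _, hne, hEe.le⟩)
  exact absurd (Finset.card_erase_lt_of_mem hx) this.not_gt

theorem mainTheorem6 (ℓ t : ℕ) (hℓ : 2 ≤ ℓ) (ht : 2 ≤ t) :
    ∃ C : ℝ, 0 < C ∧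
      ∀ s : ℕ, 2 ≤ s →
        ∀ (V : Type*) [Fintype V] [Nonempty V] (G : SimpleGraph V) [DecidableRel G.Adj],
          (completeBipartiteGraph (Fin s) (Fin s)).Free G →
          C * ((ℓ : ℝ) * (t : ℝ)) ^ (20 * s) * (Fintype.card V : ℝ) ^ (1 + 1 / (ℓ : ℝ))
            ≤ (G.edgeFinset.card : ℝ) →
          (thetaGraph ℓ t).IsIndContained G := by
  have hq : (0 : ℝ) < (ℓ : ℝ) * t :=
    mul_pos (Nat.cast_pos.2 (by omega)) (Nat.cast_pos.2 (by omega))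
  -- The power `16` joins `20 s` in the exponent required by the minimum degree case.
  refine ⟨((ℓ : ℝ) * t) ^ 16, by positivity, ?_⟩
  intro s hs V _ _ G _ hG hedge
  classical
  have hV : (0 : ℝ) < Fintype.card V := Nat.cast_pos.2 Fintype.card_pos
  set δ : ℝ := ((ℓ : ℝ) * t) ^ (20 * s + 16) * (Fintype.card V : ℝ) ^ (1 / (ℓ : ℝ)) with hδ
  obtain ⟨S, hS, hdeg⟩ := exists_le_sum_adjMatrix G (δ := δ) (by
    refine le_trans (le_of_eq ?_) hedge
    rw [Real.rpow_add hV, Real.rpow_one, hδ, pow_add]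
    ring)
  have : Nonempty {x // x ∈ S} := hS.to_subtype
  let e : {x // x ∈ S} ↪ V := Function.Embedding.subtype _
  have hemb : (G.comap e).IsIndContained G := ⟨SimpleGraph.Embedding.comap e G⟩
  refine SimpleGraph.IsIndContained.trans ?_ hemb
  refine thetaGraph_isIndContained_of_le_degree hℓ ht hs (G.comap e)
    (fun h => hG (h.trans hemb.isContained)) fun x => ?_
  have h1 : ((G.comap e).degree x : ℝ) = ∑ y ∈ S, G.adjMatrix ℝ x y := by
    rw [← sum_adjMatrix_apply, ← Finset.sum_coe_sort S fun y => G.adjMatrix ℝ x y]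
    exact Finset.sum_congr rfl fun y _ => by
      rw [SimpleGraph.adjMatrix_apply, SimpleGraph.adjMatrix_apply]
      exact if_congr Iff.rfl rfl rfl
  rw [h1]
  -- The subgraph has at most as many vertices as `G`, so its degree threshold is no larger.
  refine le_trans ?_ (hdeg x x.2)
  rw [hδ]
  gcongr
  exact Fintype.card_subtype_le _
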